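/- Let $0<\alpha<2$, let $d\ge 1$ be an integer and let $1<p<\infty$. Let $D=\{x=(x_1,\dots,x_d)\in\mathbb{R}^d : x_d>0\}$, let $C_c(D)$ be the class of all continuous functions $u:\mathbb{R}^d\to\mathbb{R}$ with compact support contained in $D$, and for $a,k\in\mathbb{R}$ put $a^{\langle k\rangle}:=|a|^k\operatorname{sgn}a$. With $B(x,y)=\Gamma(x)\Gamma(y)/\Gamma(x+y)$ (where $\Gamma$ is extended to $\mathbb{R}\setminus\{0,-1,-2,\dots\}$ and $1/\Gamma$ to all of $\mathbb{R}$), let $$\kappa_{d,p,\alpha}=-\frac{\pi^{\frac{d-1}{2}}\,\Gamma\big(\frac{1+\alpha}{2}\big)}{\Gamma\big(\frac{\alpha+d}{2}\big)}\left(B\Big(\tfrac{\alpha-1}{p}+1,-\alpha\Big)+B\Big(\alpha-\tfrac{\alpha-1}{p},-\alpha\Big)+\tfrac1\alpha\right)\quad\text{for }\alpha\neq1,$$ and $\kappa_{d,p,1}=0$ (the limit of $\kappa_{d,p,\alpha}$ as $\alpha\to1$). Then for every $u\in C_c(D)$, $$\frac12\int_D\int_D\frac{(u(x)-u(y))\big(u(x)^{\langle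 p-1\rangle}-u(y)^{\langle p-1\rangle}\big)}{|x-y|^{d+\alpha}}\,dx\,dy\;\ge\;\kappa_{d,p,\alpha}\int_D\frac{|u(x)|^p}{x_d^{\alpha}}\,dx,$$ where the left-hand side, whose integrand is nonnegative, may be $+\infty$. The constant is the best possible: for every real $C>\kappa_{d,p,\alpha}$ there is $u\in C_c(D)$ for which the inequality with $\kappa_{d,p,\alpha}$ replaced by $C$ fails. -/

import Mathlib

open MeasureTheory
open scoped ENNReal

/-- The last coordinate `x_d` of a point `x = (x_1, …, x_d)` of `ℝ^d`, where `d ≥ 1`. -/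
def lastCoord {d : ℕ} (hd : 1 ≤ d) (x : EuclideanSpace ℝ (Fin d)) : ℝ :=
  x ⟨d - 1, Nat.sub_lt hd Nat.one_pos⟩

/-- The open half-space `D = {x ∈ ℝ^d : x_d > 0}`. -/
def halfSpace {d : ℕ} (hd : 1 ≤ d) : Set (EuclideanSpace ℝ (Fin d)) :=
  {x | 0 < lastCoord hd x}

/-- `C_c(D)`: continuous functions `u : ℝ^d → ℝ` whose support (the closure of `{u ≠ 0}`) is a
compact subset of `D`. -/
def IsCc {d : ℕ} (D : Set (EuclideanSpace ℝ (Fin d))) (u : EuclideanSpace ℝ (Fin d) → ℝ) : Prop :=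
  Continuous u ∧ HasCompactSupport u ∧ tsupport u ⊆ D

/-- The signed ("French") power `a^{⟨k⟩} = |a|^k sgn a`. -/
noncomputable def signedPow (a k : ℝ) : ℝ :=
  |a| ^ k * Real.sign a

theorem signedPow_monotone {k : ℝ} (hk : 0 < k) : Monotone fun a => signedPow a k := by
  intro a b hab
  simp only [signedPow]
  rcases lt_trichotomy a 0 with ha | rfl | ha
  · rw [Real.sign_of_neg ha]
    have h1 : 0 ≤ |a| ^ k := Real.rpow_nonneg (abs_nonneg a) k
    have h2 : 0 ≤ |b| ^ k := Real.rpow_nonneg (abs_nonneg b) k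
    rcases lt_trichotomy b 0 with hb | rfl | hb
    · rw [Real.sign_of_neg hb]
      have : |b| ^ k ≤ |a| ^ k :=
        Real.rpow_le_rpow (abs_nonneg b) (by rw [abs_of_neg ha, abs_of_neg hb]; linarith) hk.le
      linarith
    · rw [Real.sign_zero]; linarith
    · rw [Real.sign_of_pos hb]; linarith
  · rcases hab.eq_or_lt with rfl | hb
    · exact le_rfl
    · rw [Real.sign_zero, Real.sign_of_pos hb, mul_zero, mul_one]
      exact Real.rpow_nonneg (abs_nonneg b) k
  · have hb := ha.trans_le hab
    rw [Real.sign_of_pos ha, Real.sign_of_pos hb, mul_one, mul_one]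
    exact Real.rpow_le_rpow (abs_nonneg a) (by rwa [abs_of_pos ha, abs_of_pos hb]) hk.le

/-- The integrand `(u(x) - u(y)) (u(x)^{⟨p-1⟩} - u(y)^{⟨p-1⟩}) / |x - y|^{d+α}`. -/
noncomputable def bregmanIntegrand {d : ℕ} (p α : ℝ) (u : EuclideanSpace ℝ (Fin d) → ℝ)
    (x y : EuclideanSpace ℝ (Fin d)) : ℝ :=
  (u x - u y) * (signedPow (u x) (p - 1) - signedPow (u y) (p - 1)) / ‖x - y‖ ^ ((d : ℝ) + α)

/-- The integrand is nonnegative, so that its integral makes sense in `[0, ∞]`, and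
`ENNReal.ofReal` cuts nothing off. -/
theorem bregmanIntegrand_nonneg {d : ℕ} {p : ℝ} (hp : 1 < p) (α : ℝ)
    (u : EuclideanSpace ℝ (Fin d) → ℝ) (x y : EuclideanSpace ℝ (Fin d)) :
    0 ≤ bregmanIntegrand p α u x y := by
  have hm := signedPow_monotone (sub_pos.2 hp)
  refine div_nonneg ?_ (Real.rpow_nonneg (norm_nonneg _) _)
  rcases le_total (u x) (u y) with h | h
  · exact mul_nonneg_of_nonpos_of_nonpos (sub_nonpos.2 h) (sub_nonpos.2 (hm h))
  · exact mul_nonneg (sub_nonneg.2 h) (sub_nonneg.2 (hm h))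

/-- The Sobolev–Bregman form `𝓔_p[u]` of `D`, with values in `[0, ∞]` (it may be infinite). -/
noncomputable def sobolevBregmanForm {d : ℕ} (D : Set (EuclideanSpace ℝ (Fin d))) (p α : ℝ)
    (u : EuclideanSpace ℝ (Fin d) → ℝ) : ℝ≥0∞ :=
  2⁻¹ * ∫⁻ x in D, ∫⁻ y in D, ENNReal.ofReal (bregmanIntegrand p α u x y)

/-- The Hardy term `∫_D |u(x)|^p / x_d^α dx` of the half-space `D`. -/
noncomputable def hardyTerm {d : ℕ} (hd : 1 ≤ d) (p α : ℝ)
    (u : EuclideanSpace ℝ (Fin d) → ℝ) : ℝ≥0∞ :=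
  ∫⁻ x in halfSpace hd, ENNReal.ofReal (|u x| ^ p / lastCoord hd x ^ α)

/-- The expression for the Hardy constant that is valid for `α ≠ 1`. Here
`ProbabilityTheory.beta x y = Γ(x) Γ(y) / Γ(x + y)`, with `Γ` defined on all of `ℝ` by the
functional equation. -/
noncomputable def hardyConstFormula (d : ℕ) (p α : ℝ) : ℝ :=
  -(Real.pi ^ (((d : ℝ) - 1) / 2) * Real.Gamma ((1 + α) / 2) / Real.Gamma ((α + d) / 2)) *
    (ProbabilityTheory.beta ((α - 1) / p + 1) (-α) +
      ProbabilityTheory.beta (α - (α - 1) / p) (-α) + 1 / α)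

/-- The Hardy constant `κ_{d,p,α}`; at `α = 1` it is `0`, the limit of the formula as `α → 1`. -/
noncomputable def hardyConst (d : ℕ) (p α : ℝ) : ℝ :=
  if α = 1 then 0 else hardyConstFormula d p α

/-! The proof is a ground-state identity with an explicit nonnegative remainder. Put d = m + 1 and
write points of D as (z, x), with z in ℝ^m and height x > 0. The form is symmetric, so it suffices
to integrate over pairs of heights x and tx with 0 < t < 1, which absorbs the factor 1/2
(`half_mul_lintegral_lintegral_of_symm`). The form is then an integral over t of sections at a fixed
ratio of heights (`slabSection`).

The ground state is x^β with β = (α - 1)/p. For a = u(z, x) and b = u(w, tx), weighted AM-GM bounds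
the cross terms a b^{⟨p-1⟩} + b a^{⟨p-1⟩} by W(t)|a|^p + W(1/t)|b|^p, where W is `hardyWeight`, with
equality when b = t^β a ≥ 0. The gap is `youngDefect`. Let H be the Hardy term. Against the kernel,
|a|^p integrates to `slabConst` · (1 - t)^{-1-α} H, and |b|^p to t^{α-1} times that. Since pβ = α -
1, the terms left after removing the gap combine to the coefficient (1 - t^β)(1 - t^{(p-1)β}), which
is nonnegative because the two exponents have the same sign (`slabSection_bregman`). Integrating
this coefficient against (1 - t)^{-1-α} gives the Beta expression (`integral_rpow_factor`), hence κ.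
So the form equals κH plus a nonnegative remainder (`sobolevBregmanForm_eq_remainder_add`), and the
inequality follows.

For sharpness, take u = x^β φ^{2/p}. The gap is then at most quadratic in the increments of φ
(`youngDefect_le`). Let φ be a tent of width n in z times a tent of width n in log x. The Hardy term
is a constant times n^{m+1}, while the remainder is O(n^{m+1}(n^{-s} + n^{-2})) for a suitable s >
0, so the quotient tends to κ. -/

/-! ### Scaling and moments of the slab kernel -/

theorem lintegral_comp_smul_addHaar {m : ℕ} {r : ℝ} (hr : r ≠ 0)
    (f : EuclideanSpace ℝ (Fin m) → ℝ≥0∞) :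
    ∫⁻ x, f (r • x) = ENNReal.ofReal |(r ^ m)⁻¹| * ∫⁻ x, f x := by
  have h := Measure.map_addHaar_smul (volume : Measure (EuclideanSpace ℝ (Fin m))) hr
  have h2 : ∫⁻ x, f (r • x) = ∫⁻ x, f x ∂(volume.map (fun x : EuclideanSpace ℝ (Fin m) => r • x)) :=
    ((Homeomorph.smulOfNeZero r hr).toMeasurableEquiv.measurableEmbedding.lintegral_map f).symm
  rw [h2, h, lintegral_smul_measure, finrank_euclideanSpace, Fintype.card_fin, smul_eq_mul]

/-- The kernel `(|z|² + h²)^{-(m + 1 + α) / 2}` on `ℝ^m × ℝ`. -/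
noncomputable def slabKernel (m : ℕ) (α : ℝ) (z : EuclideanSpace ℝ (Fin m)) (h : ℝ) : ℝ≥0∞ :=
  ENNReal.ofReal ((‖z‖ ^ 2 + h ^ 2) ^ (-((m + 1 : ℝ) + α) / 2))

theorem slabKernel_neg (m : ℕ) (α : ℝ) (z : EuclideanSpace ℝ (Fin m)) (h : ℝ) :
    slabKernel m α z (-h) = slabKernel m α z h := by
  simp [slabKernel]

theorem slabKernel_neg_left (m : ℕ) (α : ℝ) (z : EuclideanSpace ℝ (Fin m)) (h : ℝ) :
    slabKernel m α (-z) h = slabKernel m α z h := by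
  simp [slabKernel]

theorem slabKernel_smul (m : ℕ) (α : ℝ) (z : EuclideanSpace ℝ (Fin m)) {h : ℝ} (hh : 0 < h) :
    slabKernel m α (h • z) h = ENNReal.ofReal (h ^ (-((m + 1 : ℝ) + α))) * slabKernel m α z 1 := by
  rw [slabKernel, slabKernel, ← ENNReal.ofReal_mul (by positivity)]
  congr 1
  have : ‖h • z‖ ^ 2 + h ^ 2 = h ^ 2 * (‖z‖ ^ 2 + 1 ^ 2) := by
    rw [norm_smul, Real.norm_of_nonneg hh.le]; ring
  rw [this, Real.mul_rpow (by positivity) (by positivity), ← Real.rpow_natCast h 2,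
    ← Real.rpow_mul hh.le]
  congr 2
  push_cast; ring

/-- The moments of the kernel at height one. -/
noncomputable def slabMoment (m : ℕ) (α s : ℝ) : ℝ≥0∞ :=
  ∫⁻ z : EuclideanSpace ℝ (Fin m), ENNReal.ofReal (‖z‖ ^ s) * slabKernel m α z 1

/-- Substitute z = h z': the volume gives h^m, the norm h^s and the kernel h^{-(m+1+α)}. -/
theorem lintegral_norm_rpow_mul_slabKernel (m : ℕ) (α s : ℝ) {h : ℝ} (hh : 0 < h) :
    ∫⁻ z : EuclideanSpace ℝ (Fin m), ENNReal.ofReal (‖z‖ ^ s) * slabKernel m α z h =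
      ENNReal.ofReal (h ^ (s - 1 - α)) * slabMoment m α s := by
  have h1 := lintegral_comp_smul_addHaar (m := m) hh.ne'
    (fun z => ENNReal.ofReal (‖z‖ ^ s) * slabKernel m α z h)
  simp only [slabKernel_smul m α _ hh, norm_smul, Real.norm_of_nonneg hh.le] at h1
  have h2 : ENNReal.ofReal (h ^ m) * ENNReal.ofReal |(h ^ m)⁻¹| = 1 := by
    rw [← ENNReal.ofReal_mul (by positivity), abs_of_nonneg (by positivity),
      mul_inv_cancel₀ (by positivity), ENNReal.ofReal_one]
  rw [← one_mul (∫⁻ z, _), ← h2, mul_assoc, ← h1, slabMoment,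
    ← lintegral_const_mul' _ _ ENNReal.ofReal_ne_top, ← lintegral_const_mul' _ _ ENNReal.ofReal_ne_top]
  refine lintegral_congr fun z => ?_
  rw [Real.mul_rpow hh.le (norm_nonneg _), ENNReal.ofReal_mul (by positivity)]
  have : h ^ (s - 1 - α) = h ^ m * h ^ s * h ^ (-((m + 1 : ℝ) + α)) := by
    rw [← Real.rpow_natCast h m, ← Real.rpow_add hh, ← Real.rpow_add hh]
    congr 1; ring
  rw [this, ENNReal.ofReal_mul (by positivity), ENNReal.ofReal_mul (by positivity)]
  ring

/-- The integrand decays like ‖z‖^{-(m+1+α-s)}, and this exponent exceeds the dimension m. -/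
theorem slabMoment_ne_top (m : ℕ) {α s : ℝ} (hs0 : 0 ≤ s) (hs : s < 1 + α) :
    slabMoment m α s ≠ ∞ := by
  have hi := integrable_rpow_neg_one_add_norm_sq (E := EuclideanSpace ℝ (Fin m))
    (μ := volume) (r := m + 1 + α - s) (by simp; linarith)
  refine ne_top_of_le_ne_top hi.lintegral_lt_top.ne (lintegral_mono fun z => ?_)
  rw [slabKernel, ← ENNReal.ofReal_mul (by positivity)]
  apply ENNReal.ofReal_le_ofReal
  have h1 : ‖z‖ ^ s ≤ (1 + ‖z‖ ^ 2) ^ (s / 2) := by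
    calc ‖z‖ ^ s = (‖z‖ ^ 2) ^ (s / 2) := by
          rw [← Real.rpow_natCast ‖z‖ 2, ← Real.rpow_mul (norm_nonneg _)]; congr 1; push_cast; ring
      _ ≤ _ := Real.rpow_le_rpow (by positivity) (by linarith) (by linarith)
  calc ‖z‖ ^ s * (‖z‖ ^ 2 + 1 ^ 2) ^ (-((m + 1 : ℝ) + α) / 2)
      ≤ (1 + ‖z‖ ^ 2) ^ (s / 2) * (‖z‖ ^ 2 + 1 ^ 2) ^ (-((m + 1 : ℝ) + α) / 2) := by gcongr
    _ = (1 + ‖z‖ ^ 2) ^ (-((m : ℝ) + 1 + α - s) / 2) := by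
      rw [show ‖z‖ ^ 2 + 1 ^ 2 = 1 + ‖z‖ ^ 2 by ring, ← Real.rpow_add (by positivity)]
      congr 1; ring

theorem lintegral_rpow_mul_exp_neg_mul_Ioi {a r : ℝ} (ha : 0 < a) (hr : 0 < r) :
    ∫⁻ t in Set.Ioi (0 : ℝ), ENNReal.ofReal (t ^ (a - 1) * Real.exp (-(r * t))) =
      ENNReal.ofReal ((1 / r) ^ a * Real.Gamma a) := by
  have h := Real.integral_rpow_mul_exp_neg_mul_Ioi ha hr
  rw [← h, ofReal_integral_eq_lintegral_ofReal]
  -- A non-integrable function has Bochner integral 0, which contradicts the positive value;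
  -- integrability thus follows from the formula itself.
  · by_contra hc
    rw [integral_undef hc] at h
    have := Real.Gamma_pos_of_pos ha
    have : 0 < (1 / r) ^ a * Real.Gamma a := by positivity
    linarith
  · filter_upwards [ae_restrict_mem measurableSet_Ioi] with t ht
    have : (0 : ℝ) < t := ht
    simp only [Pi.zero_apply]
    positivity

theorem lintegral_exp_neg_mul_norm_sq (m : ℕ) {b : ℝ} (hb : 0 < b) :
    ∫⁻ z : EuclideanSpace ℝ (Fin m), ENNReal.ofReal (Real.exp (-b * ‖z‖ ^ 2)) =
      ENNReal.ofReal ((Real.pi / b) ^ ((m : ℝ) / 2)) := by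
  have h := GaussianFourier.integral_rexp_neg_mul_sq_norm (V := EuclideanSpace ℝ (Fin m)) hb
  simp only [finrank_euclideanSpace, Fintype.card_fin] at h
  rw [← h, ofReal_integral_eq_lintegral_ofReal]
  · by_contra hc
    rw [integral_undef hc] at h
    have : 0 < (Real.pi / b) ^ ((m : ℝ) / 2) := by positivity
    linarith
  · exact Filter.Eventually.of_forall fun z => by positivity

/-- Write Γ(a)(1 + ‖z‖²)^{-a} as a Gamma integral in t. After Tonelli the z-integral is Gaussian and
lowers the exponent of t by m/2. -/
theorem lintegral_one_add_norm_sq_rpow (m : ℕ) {a : ℝ} (ha : (m : ℝ) / 2 < a) :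
    ∫⁻ z : EuclideanSpace ℝ (Fin m), ENNReal.ofReal ((1 + ‖z‖ ^ 2) ^ (-a)) =
      ENNReal.ofReal (Real.pi ^ ((m : ℝ) / 2) * Real.Gamma (a - m / 2) / Real.Gamma a) := by
  have hm : (0 : ℝ) ≤ (m : ℝ) / 2 := by positivity
  have ha0 : 0 < a := by linarith
  have hG := Real.Gamma_pos_of_pos ha0
  have key : ENNReal.ofReal (Real.Gamma a) *
      ∫⁻ z : EuclideanSpace ℝ (Fin m), ENNReal.ofReal ((1 + ‖z‖ ^ 2) ^ (-a)) =
      ENNReal.ofReal (Real.pi ^ ((m : ℝ) / 2) * Real.Gamma (a - m / 2)) := by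
    rw [← lintegral_const_mul' _ _ ENNReal.ofReal_ne_top]
    calc ∫⁻ z : EuclideanSpace ℝ (Fin m), ENNReal.ofReal (Real.Gamma a) *
            ENNReal.ofReal ((1 + ‖z‖ ^ 2) ^ (-a))
        = ∫⁻ z : EuclideanSpace ℝ (Fin m), ∫⁻ t in Set.Ioi (0 : ℝ),
            ENNReal.ofReal (t ^ (a - 1) * Real.exp (-((1 + ‖z‖ ^ 2) * t))) := by
          refine lintegral_congr fun z => ?_
          rw [lintegral_rpow_mul_exp_neg_mul_Ioi ha0 (by positivity),
            ← ENNReal.ofReal_mul hG.le, one_div, Real.inv_rpow (by positivity),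
            Real.rpow_neg (by positivity), mul_comm]
      _ = ∫⁻ t in Set.Ioi (0 : ℝ), ∫⁻ z : EuclideanSpace ℝ (Fin m),
            ENNReal.ofReal (t ^ (a - 1) * Real.exp (-((1 + ‖z‖ ^ 2) * t))) := by
          apply lintegral_lintegral_swap
          apply Measurable.aemeasurable
          fun_prop
      _ = ∫⁻ t in Set.Ioi (0 : ℝ), ENNReal.ofReal (Real.pi ^ ((m : ℝ) / 2)) *
            ENNReal.ofReal (t ^ (a - m / 2 - 1) * Real.exp (-(1 * t))) := by
          refine setLIntegral_congr_fun measurableSet_Ioi fun t ht => ?_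
          have ht : (0 : ℝ) < t := ht
          have : ∀ z : EuclideanSpace ℝ (Fin m),
              ENNReal.ofReal (t ^ (a - 1) * Real.exp (-((1 + ‖z‖ ^ 2) * t))) =
              ENNReal.ofReal (t ^ (a - 1) * Real.exp (-t)) *
                ENNReal.ofReal (Real.exp (-t * ‖z‖ ^ 2)) := fun z => by
            rw [← ENNReal.ofReal_mul (by positivity), mul_assoc, ← Real.exp_add]
            congr 3; ring
          simp only [this]
          rw [lintegral_const_mul' _ _ ENNReal.ofReal_ne_top, lintegral_exp_neg_mul_norm_sq m ht,
            ← ENNReal.ofReal_mul (by positivity), ← ENNReal.ofReal_mul (by positivity)]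
          congr 1
          rw [Real.div_rpow Real.pi_pos.le ht.le, show a - m / 2 - 1 = (a - 1) - m / 2 by ring,
            Real.rpow_sub ht (a - 1), one_mul]
          ring
      _ = _ := by
          rw [lintegral_const_mul' _ _ ENNReal.ofReal_ne_top,
            lintegral_rpow_mul_exp_neg_mul_Ioi (by linarith) one_pos,
            ← ENNReal.ofReal_mul (by positivity)]
          simp
  rw [ENNReal.ofReal_div_of_pos hG, ← key, mul_comm, mul_div_assoc,
    ENNReal.div_self (by simpa using hG) ENNReal.ofReal_ne_top, mul_one]

/-- The constant relating the kernel on `ℝ^m × ℝ` to the kernel on `ℝ`. -/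
noncomputable def slabConst (m : ℕ) (α : ℝ) : ℝ :=
  Real.pi ^ ((m : ℝ) / 2) * Real.Gamma ((1 + α) / 2) / Real.Gamma ((α + m + 1) / 2)

theorem slabConst_pos (m : ℕ) {α : ℝ} (hα : 0 < α) : 0 < slabConst m α := by
  have h1 := Real.Gamma_pos_of_pos (show 0 < (1 + α) / 2 by linarith)
  have h2 := Real.Gamma_pos_of_pos (show 0 < (α + m + 1) / 2 by positivity)
  unfold slabConst
  positivity

theorem slabMoment_zero (m : ℕ) {α : ℝ} (hα : 0 < α) :
    slabMoment m α 0 = ENNReal.ofReal (slabConst m α) := by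
  have := lintegral_one_add_norm_sq_rpow m (a := (α + m + 1) / 2) (by linarith)
  rw [show (α + m + 1) / 2 - m / 2 = (1 + α) / 2 by ring] at this
  rw [slabConst, ← this, slabMoment]
  refine lintegral_congr fun z => ?_
  rw [slabKernel, Real.rpow_zero, ENNReal.ofReal_one, one_mul]
  congr 1
  rw [show ‖z‖ ^ 2 + 1 ^ 2 = 1 + ‖z‖ ^ 2 by ring]
  congr 1; ring

theorem lintegral_slabKernel (m : ℕ) {α h : ℝ} (hα : 0 < α) (hh : 0 < h) :
    ∫⁻ z : EuclideanSpace ℝ (Fin m), slabKernel m α z h =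
      ENNReal.ofReal (slabConst m α * h ^ (-1 - α)) := by
  have := lintegral_norm_rpow_mul_slabKernel m α 0 hh
  simp only [Real.rpow_zero, ENNReal.ofReal_one, one_mul, slabMoment_zero m hα] at this
  rw [this, ← ENNReal.ofReal_mul (by positivity), mul_comm]
  congr 3
  ring

/-! ### Passing to the ratio of the heights -/

theorem ofReal_mul_lintegral_comp_mul_left {a : ℝ} (ha : 0 < a) (f : ℝ → ℝ≥0∞) :
    ENNReal.ofReal a * ∫⁻ t, f (a * t) = ∫⁻ y, f y := by
  have h := Real.smul_map_volume_mul_left ha.ne'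
  conv_rhs => rw [← h]
  rw [lintegral_smul_measure, abs_of_pos ha, smul_eq_mul]
  congr 1
  exact ((Homeomorph.mulLeft₀ a ha.ne').toMeasurableEquiv.measurableEmbedding.lintegral_map f).symm

theorem ofReal_mul_setLIntegral_Ioi_comp_mul_left {a : ℝ} (ha : 0 < a) (f : ℝ → ℝ≥0∞) :
    ENNReal.ofReal a * ∫⁻ t in Set.Ioi 0, f (a * t) = ∫⁻ y in Set.Ioi 0, f y := by
  rw [← lintegral_indicator measurableSet_Ioi, ← lintegral_indicator measurableSet_Ioi,
    ← ofReal_mul_lintegral_comp_mul_left ha ((Set.Ioi 0).indicator f)]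
  congr 1
  refine lintegral_congr fun t => ?_
  simp [Set.indicator, ha]

theorem ofReal_mul_setLIntegral_Ioo_comp_mul_left {a : ℝ} (ha : 0 < a) (f : ℝ → ℝ≥0∞) :
    ENNReal.ofReal a * ∫⁻ t in Set.Ioo 0 1, f (a * t) = ∫⁻ y in Set.Ioo 0 a, f y := by
  rw [← lintegral_indicator measurableSet_Ioo, ← lintegral_indicator measurableSet_Ioo,
    ← ofReal_mul_lintegral_comp_mul_left ha ((Set.Ioo 0 a).indicator f)]
  congr 1
  refine lintegral_congr fun t => ?_
  simp [Set.indicator, ha]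

/-- The regions y < x and y > x contribute equally by symmetry, and the diagonal is null. On y < x,
substitute y = tx, with Jacobian x. -/
theorem half_mul_lintegral_lintegral_of_symm {Q : ℝ → ℝ → ℝ≥0∞}
    (hQ : Measurable (Function.uncurry Q)) (hs : ∀ x y, Q x y = Q y x) :
    2⁻¹ * ∫⁻ x in Set.Ioi 0, ∫⁻ y in Set.Ioi 0, Q x y =
      ∫⁻ t in Set.Ioo (0 : ℝ) 1, ∫⁻ x in Set.Ioi 0, ENNReal.ofReal x * Q x (t * x) := by
  have hlow : ∫⁻ x in Set.Ioi (0 : ℝ), ∫⁻ y in Set.Ioo 0 x, Q x y =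
      ∫⁻ t in Set.Ioo (0 : ℝ) 1, ∫⁻ x in Set.Ioi 0, ENNReal.ofReal x * Q x (t * x) := by
    rw [lintegral_lintegral_swap]
    · refine setLIntegral_congr_fun measurableSet_Ioi fun x hx => ?_
      have hx : (0 : ℝ) < x := hx
      rw [lintegral_const_mul' _ _ ENNReal.ofReal_ne_top,
        ← ofReal_mul_setLIntegral_Ioo_comp_mul_left hx]
      simp only [mul_comm x]
    · apply Measurable.aemeasurable
      exact (ENNReal.measurable_ofReal.comp measurable_snd).mul
        (hQ.comp (measurable_snd.prodMk (measurable_fst.mul measurable_snd)))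
  have hup : ∫⁻ x in Set.Ioi (0 : ℝ), ∫⁻ y in Set.Ioi x, Q x y =
      ∫⁻ x in Set.Ioi (0 : ℝ), ∫⁻ y in Set.Ioo 0 x, Q x y := by
    have e1 : ∀ x : ℝ, ∫⁻ y in Set.Ioi x, Q x y = ∫⁻ y, (Set.Ioi x).indicator (Q x) y :=
      fun x => (lintegral_indicator measurableSet_Ioi _).symm
    have e2 : ∀ x : ℝ, ∫⁻ y in Set.Ioo 0 x, Q x y = ∫⁻ y, (Set.Ioo 0 x).indicator (Q x) y :=
      fun x => (lintegral_indicator measurableSet_Ioo _).symm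
    simp only [e1, e2]
    rw [← lintegral_indicator measurableSet_Ioi, ← lintegral_indicator measurableSet_Ioi]
    have e3 : ∀ x : ℝ, (Set.Ioi (0 : ℝ)).indicator (fun x => ∫⁻ y, (Set.Ioi x).indicator (Q x) y) x
        = ∫⁻ y, {q : ℝ × ℝ | 0 < q.1 ∧ q.1 < q.2}.indicator (Function.uncurry Q) (x, y) := by
      intro x
      by_cases hx : 0 < x <;> simp [Set.indicator, hx, Function.uncurry]
    have e4 : ∀ x : ℝ, (Set.Ioi (0 : ℝ)).indicator
        (fun x => ∫⁻ y, (Set.Ioo 0 x).indicator (Q x) y) x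
        = ∫⁻ y, {q : ℝ × ℝ | 0 < q.1 ∧ q.1 < q.2}.indicator (Function.uncurry Q) (y, x) := by
      intro x
      by_cases hx : 0 < x
      · rw [Set.indicator_of_mem (Set.mem_Ioi.2 hx)]
        refine lintegral_congr fun y => ?_
        by_cases hy : 0 < y ∧ y < x
        · rw [Set.indicator_of_mem (Set.mem_Ioo.2 hy), Set.indicator_of_mem
            (s := {q : ℝ × ℝ | 0 < q.1 ∧ q.1 < q.2}) hy, hs x]
          rfl
        · rw [Set.indicator_of_notMem (s := Set.Ioo 0 x) hy, Set.indicator_of_notMem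
            (s := {q : ℝ × ℝ | 0 < q.1 ∧ q.1 < q.2}) hy]
      · have : ∀ y : ℝ, ¬ (0 < y ∧ y < x) := fun y hy => hx (hy.1.trans hy.2)
        simp [Set.indicator, hx, this]
    simp only [e3, e4]
    apply lintegral_lintegral_swap
    apply Measurable.aemeasurable
    have hm : MeasurableSet {q : ℝ × ℝ | 0 < q.1 ∧ q.1 < q.2} :=
      (measurableSet_lt measurable_const measurable_fst).inter
        (measurableSet_lt measurable_fst measurable_snd)
    exact hQ.indicator hm
  have hsplit : ∀ x ∈ Set.Ioi (0 : ℝ), ∫⁻ y in Set.Ioi 0, Q x y =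
      (∫⁻ y in Set.Ioo 0 x, Q x y) + ∫⁻ y in Set.Ioi x, Q x y := by
    intro x hx
    have hx : (0 : ℝ) < x := hx
    rw [← Set.Ioc_union_Ioi_eq_Ioi hx.le, lintegral_union measurableSet_Ioi
      (Set.disjoint_left.2 fun y hy hy' => not_lt.2 hy.2 hy')]
    congr 1
    exact setLIntegral_congr Ioo_ae_eq_Ioc.symm
  have hmeas : Measurable fun x : ℝ => ∫⁻ y in Set.Ioo 0 x, Q x y := by
    have : (fun x : ℝ => ∫⁻ y in Set.Ioo 0 x, Q x y) = fun x : ℝ => ∫⁻ y,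
        {q : ℝ × ℝ | 0 < q.2 ∧ q.2 < q.1}.indicator (Function.uncurry Q) (x, y) := by
      funext x
      rw [← lintegral_indicator measurableSet_Ioo]
      rfl
    rw [this]
    have hm : MeasurableSet {q : ℝ × ℝ | 0 < q.2 ∧ q.2 < q.1} :=
      (measurableSet_lt measurable_const measurable_snd).inter
        (measurableSet_lt measurable_snd measurable_fst)
    exact (hQ.indicator hm).lintegral_prod_right'
  rw [setLIntegral_congr_fun measurableSet_Ioi hsplit, lintegral_add_left hmeas, hup, hlow,
    ← two_mul, ← mul_assoc, ENNReal.inv_mul_cancel (by norm_num) (by norm_num), one_mul]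

/-! ### Beta integrals and the evaluation of the constant -/

theorem lintegral_rpow_mul_one_sub_rpow {a b : ℝ} (ha : 0 < a) (hb : 0 < b) :
    ∫⁻ t in Set.Ioo (0 : ℝ) 1, ENNReal.ofReal (t ^ (a - 1) * (1 - t) ^ (b - 1)) =
      ENNReal.ofReal (ProbabilityTheory.beta a b) := by
  have hB := ProbabilityTheory.beta_pos ha hb
  have h := ProbabilityTheory.lintegral_betaPDF_eq_one ha hb
  rw [ProbabilityTheory.lintegral_betaPDF] at h
  simp only [mul_assoc, ENNReal.ofReal_mul (one_div_pos.2 hB).le] at h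
  rw [lintegral_const_mul' _ _ ENNReal.ofReal_ne_top] at h
  calc _ = ENNReal.ofReal (ProbabilityTheory.beta a b) *
        (ENNReal.ofReal (1 / ProbabilityTheory.beta a b) *
        ∫⁻ t in Set.Ioo (0 : ℝ) 1, ENNReal.ofReal (t ^ (a - 1) * (1 - t) ^ (b - 1))) := by
        rw [← mul_assoc, ← ENNReal.ofReal_mul hB.le, mul_one_div_cancel hB.ne',
          ENNReal.ofReal_one, one_mul]
    _ = _ := by rw [h, mul_one]

theorem lintegral_rpow_mul_one_sub_rpow_ne_top {a b : ℝ} (ha : -1 < a) (hb : -1 < b) :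
    ∫⁻ t in Set.Ioo (0 : ℝ) 1, ENNReal.ofReal (t ^ a * (1 - t) ^ b) ≠ ∞ := by
  have := lintegral_rpow_mul_one_sub_rpow (a := a + 1) (b := b + 1) (by linarith) (by linarith)
  simp only [add_sub_cancel_right] at this
  rw [this]
  exact ENNReal.ofReal_ne_top

theorem integrableOn_rpow_mul_one_sub_rpow {a b : ℝ} (ha : -1 < a) (hb : -1 < b) :
    IntegrableOn (fun t : ℝ => t ^ a * (1 - t) ^ b) (Set.Ioo 0 1) := by
  rw [IntegrableOn, ← lintegral_ofReal_ne_top_iff_integrable]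
  · exact lintegral_rpow_mul_one_sub_rpow_ne_top ha hb
  · exact Measurable.aestronglyMeasurable (by fun_prop)
  · filter_upwards [ae_restrict_mem measurableSet_Ioo] with t ht
    have := ht.1
    have : 0 < 1 - t := by linarith [ht.2]
    simp only [Pi.zero_apply]
    positivity

theorem integral_rpow_mul_one_sub_rpow {a b : ℝ} (ha : -1 < a) (hb : -1 < b) :
    ∫ t in Set.Ioo (0 : ℝ) 1, t ^ a * (1 - t) ^ b = ProbabilityTheory.beta (a + 1) (b + 1) := by
  have := lintegral_rpow_mul_one_sub_rpow (a := a + 1) (b := b + 1) (by linarith) (by linarith)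
  simp only [add_sub_cancel_right] at this
  rw [← ENNReal.ofReal_eq_ofReal_iff _ (ProbabilityTheory.beta_pos (by linarith) (by linarith)).le,
    ← this, ofReal_integral_eq_lintegral_ofReal (integrableOn_rpow_mul_one_sub_rpow ha hb)]
  · filter_upwards [ae_restrict_mem measurableSet_Ioo] with t ht
    have := ht.1
    have : 0 < 1 - t := by linarith [ht.2]
    simp only [Pi.zero_apply]
    positivity
  · refine setIntegral_nonneg measurableSet_Ioo fun t ht => ?_
    have := ht.1
    have : 0 < 1 - t := by linarith [ht.2]
    positivity

/-- For b ≥ 0 this is t ≤ t^b; for b < 0 factor out t^b first. Two such factors turn the singularity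
(1 - t)^{-1-α} into (1 - t)^{1-α}, which is integrable at 1 when α < 2. -/
theorem abs_one_sub_rpow_le {b t : ℝ} (hb : |b| ≤ 1) (ht0 : 0 < t) (ht1 : t < 1) :
    |1 - t ^ b| ≤ (1 - t) * (1 + t ^ b) := by
  have h1 := abs_le.1 hb
  have hp : 0 < t ^ b := Real.rpow_pos_of_pos ht0 b
  rcases le_total 0 b with h | h
  · have h2 : t ^ b ≤ 1 := Real.rpow_le_one ht0.le ht1.le h
    have h3 : t ≤ t ^ b := by
      simpa using Real.rpow_le_rpow_of_exponent_ge ht0 ht1.le h1.2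
    rw [abs_of_nonneg (by linarith)]
    nlinarith
  · have h2 : 1 ≤ t ^ b := Real.one_le_rpow_of_pos_of_le_one_of_nonpos ht0 ht1.le h
    have h3 : t * t ^ b ≤ 1 := by
      have : t * t ^ b = t ^ (1 + b) := by rw [Real.rpow_add ht0, Real.rpow_one]
      rw [this]
      exact Real.rpow_le_one ht0.le ht1.le (by linarith)
    rw [abs_of_nonpos (by linarith)]
    nlinarith

/-- Two steps of the functional equation of Γ, in numerator and denominator, move the second
argument to 2 - α, which is positive for α < 2, so that a convergent integral represents the value.
-/
theorem beta_neg_eq {s α : ℝ} (hα0 : 0 < α) (hα1 : α ≠ 1) (hs : s - α ≠ 0) (hs' : s + 1 - α ≠ 0) :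
    ProbabilityTheory.beta s (-α) =
      (s - α) * (s + 1 - α) / (α * (α - 1)) * ProbabilityTheory.beta s (2 - α) := by
  have e1 : Real.Gamma (2 - α) = (1 - α) * (-α * Real.Gamma (-α)) := by
    rw [show 2 - α = (1 - α) + 1 by ring, Real.Gamma_add_one (sub_ne_zero.2 hα1.symm),
      show 1 - α = -α + 1 by ring, Real.Gamma_add_one (by linarith)]
  have e2 : Real.Gamma (s + (2 - α)) = (s + 1 - α) * ((s - α) * Real.Gamma (s - α)) := by
    rw [show s + (2 - α) = (s + 1 - α) + 1 by ring, Real.Gamma_add_one hs',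
      show s + 1 - α = (s - α) + 1 by ring, Real.Gamma_add_one hs]
  have h1 : α - 1 ≠ 0 := sub_ne_zero.2 hα1
  rw [ProbabilityTheory.beta, ProbabilityTheory.beta, e1, e2, ← sub_eq_add_neg]
  -- `Real.Gamma` is 0 at its poles; both denominators then vanish, and both sides are 0.
  by_cases hG : Real.Gamma (s - α) = 0
  · simp [hG]
  · field_simp
    ring

/-- The integral counterpart of `beta_neg_eq`, with the same factor: up to a boundary term, the
exponent of 1 - t rises from -1 - α to 1 - α. -/
theorem hasDerivAt_beta_primitive {s α t : ℝ} (hα0 : 0 < α) (hα1 : α ≠ 1) (ht0 : 0 < t)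
    (ht1 : t < 1) :
    HasDerivAt (fun t : ℝ => t ^ s * (1 - t) ^ (-α) / α -
        (s - α) / (α * (α - 1)) * (t ^ s * (1 - t) ^ (1 - α)))
      (t ^ (s - 1) * (1 - t) ^ (-1 - α) -
        (s - α) * (s + 1 - α) / (α * (α - 1)) * (t ^ (s - 1) * (1 - t) ^ (1 - α))) t := by
  have h1 : 0 < 1 - t := by linarith
  have hs : HasDerivAt (fun t : ℝ => t ^ s) (s * t ^ (s - 1)) t :=
    Real.hasDerivAt_rpow_const (Or.inl ht0.ne')
  have hr : ∀ r : ℝ, HasDerivAt (fun t : ℝ => (1 - t) ^ r) (-(r * (1 - t) ^ (r - 1))) t := by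
    intro r
    have := ((hasDerivAt_id t).const_sub 1).rpow_const (p := r) (Or.inl h1.ne')
    refine this.congr_deriv ?_
    simp only [id]
    ring
  have h2 := ((hs.mul (hr (-α))).div_const α).sub
    ((hs.mul (hr (1 - α))).const_mul ((s - α) / (α * (α - 1))))
  refine h2.congr_deriv ?_
  have e1 : t ^ s = t ^ (s - 1) * t := by
    rw [← Real.rpow_add_one ht0.ne']; congr 1; ring
  have e2 : (1 - t) ^ (-α) = (1 - t) ^ (-1 - α) * (1 - t) := by
    rw [← Real.rpow_add_one h1.ne']; congr 1; ring
  have e3 : (1 - t) ^ (1 - α) = (1 - t) ^ (-1 - α) * (1 - t) * (1 - t) := by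
    rw [← Real.rpow_add_one h1.ne', ← Real.rpow_add_one h1.ne']; congr 1; ring
  rw [show -α - 1 = -1 - α by ring, show 1 - α - 1 = -α by ring, e1, e3, e2]
  have h3 : α - 1 ≠ 0 := sub_ne_zero.2 hα1
  field_simp
  ring

theorem rpow_factor_nonneg {β γ t : ℝ} (hβγ : 0 ≤ β * γ) (ht0 : 0 < t) (ht1 : t < 1) :
    0 ≤ (1 - t ^ β) * (1 - t ^ γ) := by
  rcases le_total 0 β with hβ | hβ <;> rcases le_total 0 γ with hγ | hγ
  · exact mul_nonneg (sub_nonneg.2 (Real.rpow_le_one ht0.le ht1.le hβ))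
      (sub_nonneg.2 (Real.rpow_le_one ht0.le ht1.le hγ))
  · rcases mul_eq_zero.1 (le_antisymm (mul_nonpos_of_nonneg_of_nonpos hβ hγ) hβγ) with h | h <;>
      simp [h]
  · rcases mul_eq_zero.1 (le_antisymm (mul_nonpos_of_nonpos_of_nonneg hβ hγ) hβγ) with h | h <;>
      simp [h]
  · exact mul_nonneg_of_nonpos_of_nonpos
      (sub_nonpos.2 (Real.one_le_rpow_of_pos_of_le_one_of_nonpos ht0 ht1.le hβ))
      (sub_nonpos.2 (Real.one_le_rpow_of_pos_of_le_one_of_nonpos ht0 ht1.le hγ))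

theorem rpow_factor_le {β γ α t : ℝ} (hβ : |β| ≤ 1) (hγ : |γ| ≤ 1) (ht0 : 0 < t) (ht1 : t < 1) :
    |(1 - t ^ β) * (1 - t ^ γ) * (1 - t) ^ (-1 - α)| ≤
      t ^ (0 : ℝ) * (1 - t) ^ (1 - α) + t ^ β * (1 - t) ^ (1 - α) + t ^ γ * (1 - t) ^ (1 - α) +
        t ^ (β + γ) * (1 - t) ^ (1 - α) := by
  have h1 : 0 < 1 - t := by linarith
  have e : (1 - t) ^ (1 - α) = (1 - t) ^ (-1 - α) * (1 - t) * (1 - t) := by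
    rw [← Real.rpow_add_one h1.ne', ← Real.rpow_add_one h1.ne']; congr 1; ring
  rw [abs_mul, abs_mul, abs_of_nonneg (Real.rpow_nonneg h1.le (-1 - α))]
  calc |1 - t ^ β| * |1 - t ^ γ| * (1 - t) ^ (-1 - α)
      ≤ ((1 - t) * (1 + t ^ β)) * ((1 - t) * (1 + t ^ γ)) * (1 - t) ^ (-1 - α) := by
        refine mul_le_mul_of_nonneg_right ?_ (Real.rpow_nonneg h1.le _)
        exact mul_le_mul (abs_one_sub_rpow_le hβ ht0 ht1) (abs_one_sub_rpow_le hγ ht0 ht1)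
          (abs_nonneg _) (mul_nonneg h1.le (by positivity))
    _ = _ := by
        rw [e, Real.rpow_add ht0, Real.rpow_zero]
        ring

theorem integrableOn_rpow_factor {β γ α : ℝ} (hβ : |β| < 1) (hγ : |γ| < 1) (hα : α < 2)
    (hβγ : -1 < β + γ) :
    IntegrableOn (fun t : ℝ => (1 - t ^ β) * (1 - t ^ γ) * (1 - t) ^ (-1 - α)) (Set.Ioo 0 1) := by
  have i : ∀ a : ℝ, -1 < a →
      IntegrableOn (fun t : ℝ => t ^ a * (1 - t) ^ (1 - α)) (Set.Ioo 0 1) := fun a ha =>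
    integrableOn_rpow_mul_one_sub_rpow ha (by linarith)
  have hi := (((i 0 (by norm_num)).add (i β (abs_lt.1 hβ).1)).add (i γ (abs_lt.1 hγ).1)).add
    (i (β + γ) hβγ)
  refine Integrable.mono' hi (Measurable.aestronglyMeasurable (by fun_prop)) ?_
  filter_upwards [ae_restrict_mem measurableSet_Ioo] with t ht
  exact rpow_factor_le hβ.le hγ.le ht.1 ht.2

/-- Each primitive alone is singular at t = 1. The signed combination gains a double zero there, and
the bound tends to 0 at both ends of (0, 1), so no boundary terms survive. -/
theorem exists_bound_beta_primitive {β γ α : ℝ} (hβ : |β| < 1) (hγ : |γ| < 1) (hα0 : 0 < α)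
    (hα1 : α ≠ 1) (hα2 : α < 2) (hβγ : β + γ = α - 1) :
    let P := fun s t : ℝ => t ^ s * (1 - t) ^ (-α) / α -
        (s - α) / (α * (α - 1)) * (t ^ s * (1 - t) ^ (1 - α))
    ∃ C : ℝ, ∀ t ∈ Set.Ioo (0 : ℝ) 1,
      |P 1 t - P (β + 1) t - P (γ + 1) t + P α t| ≤
        C * ((1 - t) ^ (2 - α) * (t + t ^ (β + 1) + t ^ (γ + 1) + t ^ α)) := by
  intro P
  have hα1' : α - 1 ≠ 0 := sub_ne_zero.2 hα1
  refine ⟨1 / α + |γ / (α * (α - 1))| + |β / (α * (α - 1))|, fun t ht => ?_⟩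
  have ht0 := ht.1
  have h1 : 0 < 1 - t := by linarith [ht.2]
  have eβ : t ^ (β + 1) = t ^ β * t := Real.rpow_add_one ht0.ne' β
  have eγ : t ^ (γ + 1) = t ^ γ * t := Real.rpow_add_one ht0.ne' γ
  have eα : t ^ α = t ^ β * t ^ γ * t := by
    rw [← Real.rpow_add ht0, ← Real.rpow_add_one ht0.ne']; congr 1; linarith
  have e1 : (1 - t) ^ (1 - α) = (1 - t) ^ (-α) * (1 - t) := by
    rw [← Real.rpow_add_one h1.ne']; congr 1; ring
  have e2 : (1 - t) ^ (2 - α) = (1 - t) ^ (-α) * (1 - t) * (1 - t) := by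
    rw [← Real.rpow_add_one h1.ne', ← Real.rpow_add_one h1.ne']; congr 1; ring
  -- As β + γ = α - 1, the coefficients s - α, taken with their signs, sum to zero; hence the (1 -
  -- t)^{1-α} terms also factor through 1 - t^β and 1 - t^γ.
  have hP : P 1 t - P (β + 1) t - P (γ + 1) t + P α t =
      t * (1 - t) ^ (-α) * ((1 - t ^ β) * (1 - t ^ γ) * (1 / α) +
        (1 - t) * ((1 - t ^ β) * (γ / (α * (α - 1))) + (1 - t ^ γ) * (β / (α * (α - 1))))) := by
    simp only [P, Real.rpow_one, eβ, eγ, eα, e1]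
    have : α = β + γ + 1 := by linarith
    have h3 : β + γ ≠ 0 := by rw [hβγ]; exact hα1'
    have h4 : β + γ + 1 ≠ 0 := by linarith
    generalize (1 - t) ^ (-α) = w
    subst this
    rw [show β + γ + 1 - 1 = β + γ by ring]
    field_simp
    ring
  set A := t ^ β with hA
  set B := t ^ γ with hB
  set w := (1 - t) ^ (-α) with hw
  have hA0 : 0 < A := Real.rpow_pos_of_pos ht0 _
  have hB0 : 0 < B := Real.rpow_pos_of_pos ht0 _
  have hw0 : 0 < w := Real.rpow_pos_of_pos h1 _
  have bA : |1 - A| ≤ (1 - t) * (1 + A) := abs_one_sub_rpow_le hβ.le ht0 ht.2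
  have bB : |1 - B| ≤ (1 - t) * (1 + B) := abs_one_sub_rpow_le hγ.le ht0 ht.2
  rw [hP, abs_mul, abs_of_pos (mul_pos ht0 hw0), e2, eβ, eγ, eα]
  have hg := abs_nonneg (γ / (α * (α - 1)))
  have hb := abs_nonneg (β / (α * (α - 1)))
  have key : |(1 - A) * (1 - B) * (1 / α) + (1 - t) * ((1 - A) * (γ / (α * (α - 1))) +
      (1 - B) * (β / (α * (α - 1))))| ≤
      ((1 - t) * (1 + A)) * ((1 - t) * (1 + B)) * (1 / α) +
      (1 - t) * (((1 - t) * (1 + A)) * |γ / (α * (α - 1))| +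
        ((1 - t) * (1 + B)) * |β / (α * (α - 1))|) := by
    refine (abs_add_le _ _).trans (add_le_add ?_ ?_)
    · rw [abs_mul, abs_mul, abs_of_pos (one_div_pos.2 hα0)]
      gcongr
    · rw [abs_mul, abs_of_pos h1]
      refine mul_le_mul_of_nonneg_left ?_ h1.le
      refine (abs_add_le _ _).trans (add_le_add ?_ ?_) <;> rw [abs_mul] <;> gcongr
  calc t * w * _ ≤ t * w * _ := by gcongr
    _ ≤ t * w * ((1 - t) * (1 - t) * ((1 + A) * (1 + B)) *
        (1 / α + |γ / (α * (α - 1))| + |β / (α * (α - 1))|)) := by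
      gcongr
      have q1 : (1 - t) * (1 - t) * (1 + A) * |γ / (α * (α - 1))| ≤
          (1 - t) * (1 - t) * ((1 + A) * (1 + B)) * |γ / (α * (α - 1))| := by
        gcongr
        nlinarith
      have q2 : (1 - t) * (1 - t) * (1 + B) * |β / (α * (α - 1))| ≤
          (1 - t) * (1 - t) * ((1 + A) * (1 + B)) * |β / (α * (α - 1))| := by
        gcongr
        nlinarith
      linarith
    _ = _ := by ring

/-- The product expands into the powers t^{s-1} with s = 1, β + 1, γ + 1, α. Separately their
integrals diverge for α > 0, so each is regularised by `hasDerivAt_beta_primitive`; the total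
derivative integrates to 0, and convergent Beta integrals remain. -/
theorem integral_rpow_factor {β γ α : ℝ} (hβ : |β| < 1) (hγ : |γ| < 1) (hα0 : 0 < α)
    (hα1 : α ≠ 1) (hα2 : α < 2) (hβ0 : β ≠ 0) (hγ0 : γ ≠ 0) (hβγ : β + γ = α - 1) :
    ∫ t in Set.Ioo (0 : ℝ) 1, (1 - t ^ β) * (1 - t ^ γ) * (1 - t) ^ (-1 - α) =
      -(ProbabilityTheory.beta (β + 1) (-α) + ProbabilityTheory.beta (γ + 1) (-α) + 1 / α) := by
  have hβ1 := abs_lt.1 hβ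
  have hγ1 := abs_lt.1 hγ
  let P := fun s t : ℝ => t ^ s * (1 - t) ^ (-α) / α -
        (s - α) / (α * (α - 1)) * (t ^ s * (1 - t) ^ (1 - α))
  let k := fun s : ℝ => (s - α) * (s + 1 - α) / (α * (α - 1))
  let P' := fun s t : ℝ => t ^ (s - 1) * (1 - t) ^ (-1 - α) -
        k s * (t ^ (s - 1) * (1 - t) ^ (1 - α))
  let b := fun s t : ℝ => t ^ (s - 1) * (1 - t) ^ (1 - α)
  have hα1' : α - 1 ≠ 0 := sub_ne_zero.2 hα1
  have hb : ∀ s : ℝ, 0 < s → IntegrableOn (b s) (Set.Ioo 0 1) := fun s hs =>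
    integrableOn_rpow_mul_one_sub_rpow (by linarith) (by linarith)
  have hbI : ∀ s : ℝ, 0 < s → ∫ t in Set.Ioo (0 : ℝ) 1, b s t = ProbabilityTheory.beta s (2 - α) :=
    fun s hs => by
      have := integral_rpow_mul_one_sub_rpow (a := s - 1) (b := 1 - α) (by linarith) (by linarith)
      rw [show s - 1 + 1 = s by ring, show 1 - α + 1 = 2 - α by ring] at this
      exact this
  let g := fun t : ℝ => (1 - t ^ β) * (1 - t ^ γ) * (1 - t) ^ (-1 - α)
  let r := fun t : ℝ => k 1 * b 1 t - k (β + 1) * b (β + 1) t - k (γ + 1) * b (γ + 1) t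
  have hg : IntegrableOn g (Set.Ioo 0 1) :=
    integrableOn_rpow_factor hβ hγ hα2 (by linarith)
  have i1 := (hb 1 one_pos).const_mul (k 1)
  have i2 := (hb (β + 1) (by linarith)).const_mul (k (β + 1))
  have i3 := (hb (γ + 1) (by linarith)).const_mul (k (γ + 1))
  have hr : IntegrableOn r (Set.Ioo 0 1) := (i1.sub i2).sub i3
  have hgr : ∀ t ∈ Set.Ioo (0 : ℝ) 1,
      P' 1 t - P' (β + 1) t - P' (γ + 1) t + P' α t = g t - r t := by
    intro t ht
    have eα : t ^ (α - 1) = t ^ β * t ^ γ := by rw [← Real.rpow_add ht.1, hβγ]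
    -- The fourth power t^{α-1} leaves no regularised term.
    have hk : k α = 0 := by simp [k]
    simp only [P', g, r, b, hk, add_sub_cancel_right, sub_self, Real.rpow_zero, eα]
    ring
  have hderiv : ∀ t ∈ Set.Ioo (0 : ℝ) 1,
      HasDerivAt (fun t => P 1 t - P (β + 1) t - P (γ + 1) t + P α t) (g t - r t) t := by
    intro t ht
    have hd : ∀ s : ℝ, HasDerivAt (P s) (P' s t) t := fun s =>
      hasDerivAt_beta_primitive hα0 hα1 ht.1 ht.2
    rw [← hgr t ht]
    exact (((hd 1).sub (hd (β + 1))).sub (hd (γ + 1))).add (hd α)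
  obtain ⟨C, hC⟩ := exists_bound_beta_primitive hβ hγ hα0 hα1 hα2 hβγ
  let M := fun t : ℝ => C * ((1 - t) ^ (2 - α) * (t + t ^ (β + 1) + t ^ (γ + 1) + t ^ α))
  have hMc : Continuous M := by
    have hc : ∀ s : ℝ, 0 < s → Continuous fun t : ℝ => t ^ s := fun s hs =>
      Real.continuous_rpow_const hs.le
    have h1 : Continuous fun t : ℝ => (1 - t) ^ (2 - α) :=
      (hc (2 - α) (by linarith)).comp (continuous_const.sub continuous_id)
    exact continuous_const.mul (h1.mul (((continuous_id.add (hc (β + 1) (by linarith))).add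
      (hc (γ + 1) (by linarith))).add (hc α hα0)))
  have hM0 : M 0 = 0 := by
    simp only [M, Real.zero_rpow (show β + 1 ≠ 0 by linarith),
      Real.zero_rpow (show γ + 1 ≠ 0 by linarith), Real.zero_rpow hα0.ne']
    ring
  have hM1 : M 1 = 0 := by
    simp only [M, sub_self, Real.zero_rpow (show 2 - α ≠ 0 by linarith)]
    ring
  have hl : Filter.Tendsto (fun t => P 1 t - P (β + 1) t - P (γ + 1) t + P α t)
      (nhdsWithin 0 (Set.Ioi 0)) (nhds 0) := by
    refine squeeze_zero_norm' ?_ ((hM0 ▸ hMc.tendsto 0).mono_left nhdsWithin_le_nhds)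
    filter_upwards [Ioo_mem_nhdsGT (zero_lt_one (α := ℝ))] with t ht using hC t ht
  have hrt : Filter.Tendsto (fun t => P 1 t - P (β + 1) t - P (γ + 1) t + P α t)
      (nhdsWithin 1 (Set.Iio 1)) (nhds 0) := by
    refine squeeze_zero_norm' ?_ ((hM1 ▸ hMc.tendsto 1).mono_left nhdsWithin_le_nhds)
    filter_upwards [Ioo_mem_nhdsLT (zero_lt_one (α := ℝ))] with t ht using hC t ht
  have hI := intervalIntegral.integral_eq_sub_of_hasDerivAt_of_tendsto zero_lt_one hderiv
    ((intervalIntegrable_iff_integrableOn_Ioo_of_le zero_le_one).2 (hg.sub hr)) hl hrt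
  rw [intervalIntegral.integral_of_le zero_le_one, integral_Ioc_eq_integral_Ioo,
    integral_sub hg hr, sub_self] at hI
  have hR : ∫ t in Set.Ioo (0 : ℝ) 1, r t = k 1 * ProbabilityTheory.beta 1 (2 - α) -
      k (β + 1) * ProbabilityTheory.beta (β + 1) (2 - α) -
      k (γ + 1) * ProbabilityTheory.beta (γ + 1) (2 - α) := by
    have : ∫ t in Set.Ioo (0 : ℝ) 1, r t = (∫ t in Set.Ioo (0 : ℝ) 1, k 1 * b 1 t) -
        (∫ t in Set.Ioo (0 : ℝ) 1, k (β + 1) * b (β + 1) t) -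
        (∫ t in Set.Ioo (0 : ℝ) 1, k (γ + 1) * b (γ + 1) t) := by
      have i12 : Integrable (fun t => k 1 * b 1 t - k (β + 1) * b (β + 1) t)
        (volume.restrict (Set.Ioo 0 1)) := i1.sub i2
      rw [← integral_sub i1 i2, ← integral_sub i12 i3]
    rw [this, integral_const_mul, integral_const_mul, integral_const_mul, hbI 1 one_pos,
      hbI _ (by linarith), hbI _ (by linarith)]
  -- The constant term 1 of the product is the source of the summand 1/α.
  have hB1 : k 1 * ProbabilityTheory.beta 1 (2 - α) = -(1 / α) := by
    have h2 : Real.Gamma (1 + (2 - α)) = (2 - α) * Real.Gamma (2 - α) := by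
      rw [add_comm, Real.Gamma_add_one (by linarith)]
    have h3 := (Real.Gamma_pos_of_pos (show 0 < 2 - α by linarith)).ne'
    have h4 : 2 - α ≠ 0 := by linarith
    simp only [k, ProbabilityTheory.beta, h2, Real.Gamma_one]
    field_simp
    ring
  -- Here β + 1 - α = -γ, and symmetrically γ + 1 - α = -β, so the poles are avoided because γ and β
  -- are nonzero.
  have hB2 := beta_neg_eq (s := β + 1) hα0 hα1 (by intro h; apply hγ0; linarith)
    (by intro h; linarith)
  have hB3 := beta_neg_eq (s := γ + 1) hα0 hα1 (by intro h; apply hβ0; linarith)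
    (by intro h; linarith)
  rw [hB2, hB3]
  simp only [g, hR, hB1, k] at hI ⊢
  linarith

/-! ### The Young defect and the ground-state substitution -/

theorem signedPow_of_nonneg {a k : ℝ} (ha : 0 ≤ a) (hk : k ≠ 0) : signedPow a k = a ^ k := by
  rcases ha.eq_or_lt with rfl | h
  · simp [signedPow, Real.zero_rpow hk]
  · rw [signedPow, Real.sign_of_pos h, abs_of_pos h, mul_one]

theorem mul_signedPow_self {p : ℝ} (hp : 1 < p) (a : ℝ) : a * signedPow a (p - 1) = |a| ^ p := by
  rcases lt_trichotomy a 0 with h | rfl | h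
  · rw [signedPow, Real.sign_of_neg h, abs_of_neg h]
    have := Real.rpow_add_one (neg_pos.2 h).ne' (p - 1)
    rw [sub_add_cancel] at this
    rw [this]; ring
  · simp [Real.zero_rpow (show p ≠ 0 by linarith)]
  · rw [signedPow, Real.sign_of_pos h, abs_of_pos h]
    have := Real.rpow_add_one h.ne' (p - 1)
    rw [sub_add_cancel] at this
    rw [this]; ring

theorem mul_signedPow_le (a b k : ℝ) : a * signedPow b k ≤ |a| * |b| ^ k := by
  refine (le_abs_self _).trans ?_
  rw [signedPow, abs_mul, abs_mul, abs_of_nonneg (Real.rpow_nonneg (abs_nonneg b) k)]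
  have : |Real.sign b| ≤ 1 := by
    rcases Real.sign_apply_eq b with h | h | h <;> simp [h]
  have h2 : 0 ≤ |b| ^ k := Real.rpow_nonneg (abs_nonneg b) k
  gcongr
  nlinarith

/-- The convex weight `(1 - 1/p) t^β + t^{(p - 1) β} / p`. -/
noncomputable def hardyWeight (p β t : ℝ) : ℝ :=
  (1 - 1 / p) * t ^ β + 1 / p * t ^ ((p - 1) * β)

/-- The defect in Young's inequality used to compare the Bregman integrand with the Hardy term. -/
noncomputable def youngDefect (p β t a b : ℝ) : ℝ :=
  |a| ^ p * hardyWeight p β t + |b| ^ p * hardyWeight p β t⁻¹ -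
    a * signedPow b (p - 1) - b * signedPow a (p - 1)

/-- The algebraic core of the Hardy identity, arranged without subtracting weights so that all the
terms are nonnegative and can be integrated in [0, ∞]. -/
theorem bregman_add_eq_youngDefect_add {p : ℝ} (hp : 1 < p) (β t a b : ℝ) :
    (a - b) * (signedPow a (p - 1) - signedPow b (p - 1)) +
        (|a| ^ p * hardyWeight p β t + |b| ^ p * hardyWeight p β t⁻¹) =
      youngDefect p β t a b + (|a| ^ p + |b| ^ p) := by
  rw [← mul_signedPow_self hp a, ← mul_signedPow_self hp b, youngDefect,
    ← mul_signedPow_self hp a, ← mul_signedPow_self hp b]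
  ring

theorem hardyWeight_nonneg {p β t : ℝ} (hp : 1 < p) (ht : 0 ≤ t) : 0 ≤ hardyWeight p β t := by
  have : 1 / p ≤ 1 := by rw [div_le_one (by linarith)]; exact hp.le
  have h2 : 0 ≤ 1 - 1 / p := by linarith
  unfold hardyWeight
  positivity

/-- The defect in Young's inequality for squares. -/
noncomputable def squareDefect (p σ τ : ℝ) : ℝ :=
  (1 - 1 / p) * σ ^ 2 + 1 / p * τ ^ 2 - τ ^ (2 / p) * σ ^ (2 - 2 / p)

theorem squareDefect_nonneg {p σ τ : ℝ} (hp : 1 < p) (hσ : 0 ≤ σ) (hτ : 0 ≤ τ) :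
    0 ≤ squareDefect p σ τ := by
  have h1 : 1 / p ≤ 1 := by rw [div_le_one (by linarith)]; exact hp.le
  have h := Real.geom_mean_le_arith_mean2_weighted (w₁ := 1 / p) (w₂ := 1 - 1 / p)
    (p₁ := τ ^ 2) (p₂ := σ ^ 2) (by positivity) (by linarith) (by positivity) (by positivity)
    (by ring)
  rw [← Real.rpow_natCast τ, ← Real.rpow_natCast σ, ← Real.rpow_mul hτ, ← Real.rpow_mul hσ] at h
  rw [squareDefect, ← Real.rpow_natCast τ, ← Real.rpow_natCast σ]
  rw [show ((2 : ℕ) : ℝ) * (1 / p) = 2 / p by push_cast; ring,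
    show ((2 : ℕ) : ℝ) * (1 - 1 / p) = 2 - 2 / p by push_cast; ring] at h
  linarith

/-- Add the defect with σ and τ exchanged, also nonnegative. The weights now sum to 1, and the mixed
terms X, Y satisfy XY = (στ)², so X + Y ≥ 2στ. -/
theorem squareDefect_le {p σ τ : ℝ} (hp : 1 < p) (hσ : 0 ≤ σ) (hτ : 0 ≤ τ) :
    squareDefect p σ τ ≤ (σ - τ) ^ 2 := by
  have h2 := squareDefect_nonneg hp hτ hσ
  suffices squareDefect p σ τ + squareDefect p τ σ ≤ (σ - τ) ^ 2 by linarith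
  have e : ∀ x : ℝ, 0 ≤ x → x ^ (2 / p) * x ^ (2 - 2 / p) = x ^ 2 := fun x hx => by
    rw [← Real.rpow_add' hx (by norm_num), ← Real.rpow_natCast]
    congr 1; push_cast; ring
  set X := τ ^ (2 / p) * σ ^ (2 - 2 / p) with hX
  set Y := σ ^ (2 / p) * τ ^ (2 - 2 / p) with hY
  have hX0 : 0 ≤ X := by positivity
  have hY0 : 0 ≤ Y := by positivity
  have hXY : X * Y = (σ * τ) ^ 2 := by
    rw [hX, hY, mul_pow, ← e σ hσ, ← e τ hτ]; ring
  have : 2 * (σ * τ) ≤ X + Y := by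
    nlinarith [sq_nonneg (X - Y), mul_nonneg hσ hτ]
  have : squareDefect p σ τ + squareDefect p τ σ = σ ^ 2 + τ ^ 2 - X - Y := by
    rw [squareDefect, squareDefect]; ring
  rw [this]
  nlinarith

/-- Dividing by the ground state x^β leaves only AM-GM defects. The power 2/p makes the p-th powers
of the two values quadratic in σ and τ. -/
theorem youngDefect_eq {p β t x σ τ : ℝ} (hp : 1 < p) (ht : 0 < t) (hx : 0 < x) (hσ : 0 ≤ σ)
    (hτ : 0 ≤ τ) :
    youngDefect p β t (x ^ β * σ ^ (2 / p)) ((t * x) ^ β * τ ^ (2 / p)) =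
      x ^ (p * β) * (t ^ β * squareDefect p σ τ + t ^ ((p - 1) * β) * squareDefect p τ σ) := by
  have hp0 : p ≠ 0 := by linarith
  have hp1 : p - 1 ≠ 0 := by linarith
  have e1 : ∀ y s : ℝ, 0 < y → 0 ≤ s → (y ^ β * s ^ (2 / p)) ^ p = y ^ (p * β) * s ^ 2 :=
    fun y s hy hs => by
      rw [Real.mul_rpow (by positivity) (by positivity), ← Real.rpow_mul hy.le,
        ← Real.rpow_mul hs, ← Real.rpow_natCast s]
      congr 2
      · ring
      · push_cast; field_simp
  have e2 : ∀ y s : ℝ, 0 < y → 0 ≤ s →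
      (y ^ β * s ^ (2 / p)) ^ (p - 1) = y ^ ((p - 1) * β) * s ^ (2 - 2 / p) :=
    fun y s hy hs => by
      rw [Real.mul_rpow (by positivity) (by positivity), ← Real.rpow_mul hy.le,
        ← Real.rpow_mul hs]
      congr 2
      · ring
      · field_simp
  have htx := mul_pos ht hx
  rw [youngDefect, signedPow_of_nonneg (by positivity) hp1, signedPow_of_nonneg (by positivity) hp1,
    abs_of_nonneg (by positivity), abs_of_nonneg (by positivity), e1 x σ hx hσ, e1 _ τ htx hτ,
    e2 x σ hx hσ, e2 _ τ htx hτ, hardyWeight, hardyWeight, squareDefect, squareDefect]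
  simp only [Real.mul_rpow ht.le hx.le, Real.inv_rpow ht.le]
  have ex : x ^ (p * β) = x ^ β * x ^ ((p - 1) * β) := by
    rw [← Real.rpow_add hx]; congr 1; ring
  have et : t ^ (p * β) = t ^ β * t ^ ((p - 1) * β) := by
    rw [← Real.rpow_add ht]; congr 1; ring
  have ht1 := (Real.rpow_pos_of_pos ht β).ne'
  have ht2 := (Real.rpow_pos_of_pos ht ((p - 1) * β)).ne'
  rw [ex, et]
  field_simp
  ring

/-- Replacing a and b by their absolute values can only lower the defect, and for nonnegative values
`youngDefect_eq` writes it as a sum of AM-GM defects. -/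
theorem youngDefect_nonneg {p β t a b : ℝ} (hp : 1 < p) (ht : 0 < t) :
    0 ≤ youngDefect p β t a b := by
  have hp0 : p ≠ 0 := by linarith
  have hT := Real.rpow_pos_of_pos ht β
  have e : ∀ y : ℝ, 0 ≤ y → (y ^ (p / 2)) ^ (2 / p) = y := fun y hy => by
    rw [← Real.rpow_mul hy, show p / 2 * (2 / p) = 1 by field_simp, Real.rpow_one]
  -- With x = 1 every nonnegative pair has the required form; dividing by t^β in τ compensates for
  -- the ground state at height t.
  have h := youngDefect_eq (p := p) (β := β) (t := t) (x := 1) (σ := |a| ^ (p / 2))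
    (τ := (|b| / t ^ β) ^ (p / 2)) hp ht one_pos (by positivity) (by positivity)
  rw [e _ (abs_nonneg a), e _ (by positivity), Real.one_rpow, Real.one_rpow, one_mul, one_mul,
    mul_one, mul_div_cancel₀ _ hT.ne'] at h
  have h1 := squareDefect_nonneg (p := p) (σ := |a| ^ (p / 2)) (τ := (|b| / t ^ β) ^ (p / 2)) hp
    (by positivity) (by positivity)
  have h2 := squareDefect_nonneg (p := p) (τ := |a| ^ (p / 2)) (σ := (|b| / t ^ β) ^ (p / 2)) hp
    (by positivity) (by positivity)
  have h3 : 0 ≤ youngDefect p β t |a| |b| := by rw [h]; positivity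
  have h4 := mul_signedPow_le a b (p - 1)
  have h5 := mul_signedPow_le b a (p - 1)
  have hp1 : p - 1 ≠ 0 := by linarith
  rw [youngDefect, signedPow_of_nonneg (abs_nonneg a) hp1, signedPow_of_nonneg (abs_nonneg b) hp1,
    abs_abs, abs_abs] at h3
  rw [youngDefect]
  linarith

theorem youngDefect_le {p β t x σ τ : ℝ} (hp : 1 < p) (ht : 0 < t) (hx : 0 < x) (hσ : 0 ≤ σ)
    (hτ : 0 ≤ τ) :
    youngDefect p β t (x ^ β * σ ^ (2 / p)) ((t * x) ^ β * τ ^ (2 / p)) ≤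
      x ^ (p * β) * (t ^ β + t ^ ((p - 1) * β)) * (σ - τ) ^ 2 := by
  rw [youngDefect_eq hp ht hx hσ hτ, mul_assoc, add_mul]
  have h1 := squareDefect_le hp hσ hτ
  have h2 := squareDefect_le hp hτ hσ
  rw [← neg_sub, neg_sq] at h2
  gcongr

/-- The factor t^{pβ} = t^{α-1} is the ratio of the Hardy integrals at heights tx and x; with it the
fractions 1/p and 1 - 1/p recombine. -/
theorem hardyWeight_add {p β t : ℝ} (hp : 1 < p) (ht : 0 < t) :
    hardyWeight p β t + t ^ (p * β) * hardyWeight p β t⁻¹ = t ^ β + t ^ ((p - 1) * β) := by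
  have et : t ^ (p * β) = t ^ β * t ^ ((p - 1) * β) := by
    rw [← Real.rpow_add ht]; congr 1; ring
  have ht1 := (Real.rpow_pos_of_pos ht β).ne'
  have ht2 := (Real.rpow_pos_of_pos ht ((p - 1) * β)).ne'
  rw [hardyWeight, hardyWeight, et, Real.inv_rpow ht.le, Real.inv_rpow ht.le]
  have hp0 : p ≠ 0 := by linarith
  field_simp
  ring

theorem measurable_signedPow (k : ℝ) : Measurable fun a => signedPow a k := by
  have : Measurable Real.sign := by
    unfold Real.sign
    exact Measurable.ite measurableSet_Iio measurable_const
      (Measurable.ite measurableSet_Ioi measurable_const measurable_const)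
  unfold signedPow
  fun_prop

theorem measurable_youngDefect (p β : ℝ) :
    Measurable fun q : ℝ × ℝ × ℝ => youngDefect p β q.1 q.2.1 q.2.2 := by
  have := measurable_signedPow (p - 1)
  unfold youngDefect hardyWeight
  fun_prop

/-! ### The Hardy identity at a fixed ratio of heights -/

/-- The contribution of the pairs of points whose last coordinates have the ratio `t` to the double
integral of `f` against the kernel. -/
noncomputable def slabSection (m : ℕ) (α t : ℝ)
    (f : ℝ → EuclideanSpace ℝ (Fin m) → EuclideanSpace ℝ (Fin m) → ℝ≥0∞) : ℝ≥0∞ :=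
  ∫⁻ x in Set.Ioi 0, ENNReal.ofReal x *
    ∫⁻ z, ∫⁻ w, f x z w * slabKernel m α (z - w) (x * (1 - t))

@[fun_prop]
theorem Measurable.slabKernel {X : Type*} [MeasurableSpace X] {m : ℕ} {α : ℝ}
    {f : X → EuclideanSpace ℝ (Fin m)} {g : X → ℝ} (hf : Measurable f) (hg : Measurable g) :
    Measurable fun x => slabKernel m α (f x) (g x) := by
  unfold _root_.slabKernel
  fun_prop

theorem slabSection_mono {m : ℕ} {α t : ℝ}
    {f g : ℝ → EuclideanSpace ℝ (Fin m) → EuclideanSpace ℝ (Fin m) → ℝ≥0∞}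
    (h : ∀ x, 0 < x → ∀ z w, f x z w ≤ g x z w) : slabSection m α t f ≤ slabSection m α t g := by
  refine setLIntegral_mono' measurableSet_Ioi fun x hx => ?_
  gcongr with z w
  exact h x hx z w

theorem slabSection_congr {m : ℕ} {α t : ℝ}
    {f g : ℝ → EuclideanSpace ℝ (Fin m) → EuclideanSpace ℝ (Fin m) → ℝ≥0∞}
    (h : ∀ x, 0 < x → ∀ z w, f x z w = g x z w) : slabSection m α t f = slabSection m α t g :=
  le_antisymm (slabSection_mono fun x hx z w => (h x hx z w).le)
    (slabSection_mono fun x hx z w => (h x hx z w).ge)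

theorem slabSection_add {m : ℕ} {α t : ℝ}
    {f g : ℝ → EuclideanSpace ℝ (Fin m) → EuclideanSpace ℝ (Fin m) → ℝ≥0∞}
    (hf : Measurable fun q : ℝ × EuclideanSpace ℝ (Fin m) × EuclideanSpace ℝ (Fin m) =>
      f q.1 q.2.1 q.2.2) :
    slabSection m α t (fun x z w => f x z w + g x z w) =
      slabSection m α t f + slabSection m α t g := by
  have hk : Measurable fun q : ℝ × EuclideanSpace ℝ (Fin m) × EuclideanSpace ℝ (Fin m) =>
      f q.1 q.2.1 q.2.2 * slabKernel m α (q.2.1 - q.2.2) (q.1 * (1 - t)) :=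
    hf.mul (by fun_prop)
  have h1 : ∀ x : ℝ, ∀ z, Measurable fun w => f x z w * slabKernel m α (z - w) (x * (1 - t)) :=
    fun x z => hk.comp (measurable_const.prodMk (measurable_const.prodMk measurable_id))
  have h2 : ∀ x : ℝ, Measurable fun z =>
      ∫⁻ w, f x z w * slabKernel m α (z - w) (x * (1 - t)) := fun x =>
    Measurable.lintegral_prod_right' (hk.comp (measurable_const.prodMk measurable_id))
  have h3 : Measurable fun x : ℝ =>
      ∫⁻ z, ∫⁻ w, f x z w * slabKernel m α (z - w) (x * (1 - t)) := by
    refine Measurable.lintegral_prod_right'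
      (f := fun q : ℝ × EuclideanSpace ℝ (Fin m) =>
        ∫⁻ w, f q.1 q.2 w * slabKernel m α (q.2 - w) (q.1 * (1 - t))) ?_
    refine Measurable.lintegral_prod_right'
      (f := fun q : (ℝ × EuclideanSpace ℝ (Fin m)) × EuclideanSpace ℝ (Fin m) =>
        f q.1.1 q.1.2 q.2 * slabKernel m α (q.1.2 - q.2) (q.1.1 * (1 - t))) ?_
    exact hk.comp (measurable_fst.fst.prodMk (measurable_fst.snd.prodMk measurable_snd))
  have h4 : Measurable fun x : ℝ => ENNReal.ofReal x *
      ∫⁻ z, ∫⁻ w, f x z w * slabKernel m α (z - w) (x * (1 - t)) :=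
    ENNReal.measurable_ofReal.mul h3
  rw [slabSection, slabSection, slabSection, ← lintegral_add_left h4]
  refine lintegral_congr fun x => ?_
  rw [← mul_add, ← lintegral_add_left (h2 x)]
  congr 1
  refine lintegral_congr fun z => ?_
  rw [← lintegral_add_left (h1 x z)]
  refine lintegral_congr fun w => ?_
  rw [add_mul]

theorem slabSection_const_mul {m : ℕ} {α t : ℝ} {c : ℝ≥0∞} (hc : c ≠ ∞)
    (f : ℝ → EuclideanSpace ℝ (Fin m) → EuclideanSpace ℝ (Fin m) → ℝ≥0∞) :
    slabSection m α t (fun x z w => c * f x z w) = c * slabSection m α t f := by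
  rw [slabSection, slabSection, ← lintegral_const_mul' _ _ hc]
  refine lintegral_congr fun x => ?_
  rw [mul_left_comm, ← lintegral_const_mul' _ _ hc]
  congr 1
  refine lintegral_congr fun z => ?_
  rw [← lintegral_const_mul' _ _ hc]
  simp only [mul_assoc]

theorem ofReal_mul_slabConst_mul {m : ℕ} {α t x : ℝ} (hα : 0 < α) (ht1 : t < 1) (hx : 0 < x) :
    ENNReal.ofReal x * ENNReal.ofReal (slabConst m α * (x * (1 - t)) ^ (-1 - α)) =
      ENNReal.ofReal (slabConst m α * (1 - t) ^ (-1 - α)) * ENNReal.ofReal (x ^ (-α)) := by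
  have h1 : 0 < 1 - t := by linarith
  have hc := slabConst_pos m hα
  rw [← ENNReal.ofReal_mul hx.le, ← ENNReal.ofReal_mul (by positivity)]
  congr 1
  have : x ^ (-α) = x ^ (-1 - α) * x := by
    rw [← Real.rpow_add_one hx.ne']; congr 1; ring
  rw [this, Real.mul_rpow hx.le h1.le]
  ring

/-- The free variable w sees only the kernel at height x(1 - t), whose mass is `slabConst` times
(x(1 - t))^{-1-α}; the Jacobian x turns x^{-1-α} into the Hardy weight x^{-α}. -/
theorem slabSection_left {m : ℕ} {α t : ℝ} (hα : 0 < α) (ht1 : t < 1)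
    {g : ℝ → EuclideanSpace ℝ (Fin m) → ℝ≥0∞} (hg : ∀ x, Measurable (g x)) :
    slabSection m α t (fun x z _ => g x z) =
      ENNReal.ofReal (slabConst m α * (1 - t) ^ (-1 - α)) *
        ∫⁻ x in Set.Ioi 0, ENNReal.ofReal (x ^ (-α)) * ∫⁻ z, g x z := by
  rw [slabSection, ← lintegral_const_mul' _ _ ENNReal.ofReal_ne_top]
  refine setLIntegral_congr_fun measurableSet_Ioi fun x hx => ?_
  have hx : (0 : ℝ) < x := hx
  have : ∀ z, ∫⁻ w, g x z * slabKernel m α (z - w) (x * (1 - t)) =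
      g x z * ENNReal.ofReal (slabConst m α * (x * (1 - t)) ^ (-1 - α)) := fun z => by
    rw [lintegral_const_mul _ (by fun_prop),
      lintegral_sub_left_eq_self (fun w => slabKernel m α w (x * (1 - t))) z,
      lintegral_slabKernel m hα (mul_pos hx (by linarith))]
  simp only [this]
  rw [lintegral_mul_const _ (hg x), mul_comm (∫⁻ z, g x z), ← mul_assoc,
    ofReal_mul_slabConst_mul hα ht1 hx, mul_assoc]

theorem slabSection_right {m : ℕ} {α t : ℝ} (hα : 0 < α) (ht1 : t < 1)
    {g : ℝ → EuclideanSpace ℝ (Fin m) → ℝ≥0∞} (hg : ∀ x, Measurable (g x)) :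
    slabSection m α t (fun x _ w => g x w) =
      ENNReal.ofReal (slabConst m α * (1 - t) ^ (-1 - α)) *
        ∫⁻ x in Set.Ioi 0, ENNReal.ofReal (x ^ (-α)) * ∫⁻ z, g x z := by
  rw [← slabSection_left hα ht1 hg, slabSection, slabSection]
  refine lintegral_congr fun x => ?_
  congr 1
  rw [lintegral_lintegral_swap]
  · refine lintegral_congr fun z => lintegral_congr fun w => ?_
    rw [← neg_sub, slabKernel_neg_left]
  · exact (((hg x).comp measurable_snd).mul (by fun_prop)).aemeasurable

theorem lintegral_rpow_neg_mul_comp_mul_left {α t : ℝ} (ht : 0 < t) (φ : ℝ → ℝ≥0∞) :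
    ∫⁻ x in Set.Ioi 0, ENNReal.ofReal (x ^ (-α)) * φ (t * x) =
      ENNReal.ofReal (t ^ (α - 1)) * ∫⁻ x in Set.Ioi 0, ENNReal.ofReal (x ^ (-α)) * φ x := by
  rw [← ofReal_mul_setLIntegral_Ioi_comp_mul_left ht
      (fun x => ENNReal.ofReal (x ^ (-α)) * φ x), ← mul_assoc,
    ← ENNReal.ofReal_mul (by positivity), ← lintegral_const_mul' _ _ ENNReal.ofReal_ne_top]
  refine setLIntegral_congr_fun measurableSet_Ioi fun x hx => ?_
  have hx : (0 : ℝ) < x := hx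
  rw [← mul_assoc, ← ENNReal.ofReal_mul (by positivity), Real.mul_rpow ht.le hx.le, ← mul_assoc]
  congr 3
  rw [← Real.rpow_add_one ht.ne', ← Real.rpow_add ht]
  simp

/-- The Hardy term in the coordinates `ℝ^m × ℝ`. -/
noncomputable def slabHardy (m : ℕ) (p α : ℝ) (U : EuclideanSpace ℝ (Fin m) → ℝ → ℝ) : ℝ≥0∞ :=
  ∫⁻ x in Set.Ioi 0, ENNReal.ofReal (x ^ (-α)) * ∫⁻ z, ENNReal.ofReal (|U z x| ^ p)

/-- The section at the ratio `t` of the remainder in the Hardy identity. -/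
noncomputable def remainderSection (m : ℕ) (p α β t : ℝ)
    (U : EuclideanSpace ℝ (Fin m) → ℝ → ℝ) : ℝ≥0∞ :=
  slabSection m α t fun x z w => ENNReal.ofReal (youngDefect p β t (U z x) (U w (t * x)))

theorem slabSection_bregman {m : ℕ} {p α β t : ℝ} (hp : 1 < p) (hα : 0 < α) (ht0 : 0 < t)
    (ht1 : t < 1) (hβ : p * β = α - 1) (hs : 0 ≤ (1 - t ^ β) * (1 - t ^ ((p - 1) * β)))
    {U : EuclideanSpace ℝ (Fin m) → ℝ → ℝ}
    (hU : Measurable fun q : EuclideanSpace ℝ (Fin m) × ℝ => U q.1 q.2)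
    (hH : slabHardy m p α U ≠ ∞) :
    slabSection m α t (fun x z w => ENNReal.ofReal
      ((U z x - U w (t * x)) * (signedPow (U z x) (p - 1) - signedPow (U w (t * x)) (p - 1)))) =
      remainderSection m p α β t U +
        ENNReal.ofReal ((1 - t ^ β) * (1 - t ^ ((p - 1) * β)) * (1 - t) ^ (-1 - α)) *
          (ENNReal.ofReal (slabConst m α) * slabHardy m p α U) := by
  have h1 : 0 < 1 - t := by linarith
  have hc := slabConst_pos m hα
  set k := ENNReal.ofReal (slabConst m α * (1 - t) ^ (-1 - α)) with hk
  have ma : Measurable fun q : ℝ × EuclideanSpace ℝ (Fin m) × EuclideanSpace ℝ (Fin m) =>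
      U q.2.1 q.1 := hU.comp (measurable_snd.fst.prodMk measurable_fst)
  have mb : Measurable fun q : ℝ × EuclideanSpace ℝ (Fin m) × EuclideanSpace ℝ (Fin m) =>
      U q.2.2 (t * q.1) := hU.comp (measurable_snd.snd.prodMk (measurable_fst.const_mul t))
  have sA : slabSection m α t (fun x z _ => ENNReal.ofReal (|U z x| ^ p)) =
      k * slabHardy m p α U :=
    slabSection_left hα ht1 (g := fun x z => ENNReal.ofReal (|U z x| ^ p)) fun x => by
      have : Measurable fun z => U z x := hU.comp (measurable_id.prodMk measurable_const)
      fun_prop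
  have sB : slabSection m α t (fun x _ w => ENNReal.ofReal (|U w (t * x)| ^ p)) =
      ENNReal.ofReal (t ^ (α - 1)) * (k * slabHardy m p α U) := by
    rw [slabSection_right hα ht1 (g := fun x z => ENNReal.ofReal (|U z (t * x)| ^ p)) fun x => by
      have : Measurable fun z => U z (t * x) := hU.comp (measurable_id.prodMk measurable_const)
      fun_prop]
    rw [lintegral_rpow_neg_mul_comp_mul_left ht0
      (fun y => ∫⁻ z, ENNReal.ofReal (|U z y| ^ p)), mul_left_comm]
    rfl
  have mS := measurable_signedPow (p - 1)
  have hW1 : 0 ≤ hardyWeight p β t := hardyWeight_nonneg hp ht0.le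
  have hW2 : 0 ≤ hardyWeight p β t⁻¹ := hardyWeight_nonneg hp (by positivity)
  have key := slabSection_congr (m := m) (α := α) (t := t)
    (f := fun x z w => ENNReal.ofReal
      ((U z x - U w (t * x)) * (signedPow (U z x) (p - 1) - signedPow (U w (t * x)) (p - 1))) +
      (ENNReal.ofReal (hardyWeight p β t) * ENNReal.ofReal (|U z x| ^ p) +
        ENNReal.ofReal (hardyWeight p β t⁻¹) * ENNReal.ofReal (|U w (t * x)| ^ p)))
    (g := fun x z w => ENNReal.ofReal (youngDefect p β t (U z x) (U w (t * x))) +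
      (ENNReal.ofReal (|U z x| ^ p) + ENNReal.ofReal (|U w (t * x)| ^ p)))
    (fun x _ z w => by
      have hm := signedPow_monotone (sub_pos.2 hp)
      have h0 : 0 ≤ (U z x - U w (t * x)) *
          (signedPow (U z x) (p - 1) - signedPow (U w (t * x)) (p - 1)) := by
        rcases le_total (U z x) (U w (t * x)) with h | h
        · exact mul_nonneg_of_nonpos_of_nonpos (sub_nonpos.2 h) (sub_nonpos.2 (hm h))
        · exact mul_nonneg (sub_nonneg.2 h) (sub_nonneg.2 (hm h))
      rw [← ENNReal.ofReal_mul hW1, ← ENNReal.ofReal_mul hW2,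
        ← ENNReal.ofReal_add (by positivity) (by positivity),
        ← ENNReal.ofReal_add h0 (by positivity),
        ← ENNReal.ofReal_add (by positivity) (by positivity),
        ← ENNReal.ofReal_add (youngDefect_nonneg hp ht0) (by positivity),
        mul_comm (hardyWeight p β t), mul_comm (hardyWeight p β t⁻¹),
        ← bregman_add_eq_youngDefect_add hp])
  rw [slabSection_add (by fun_prop), slabSection_add (by fun_prop), slabSection_add
      ((measurable_youngDefect p β).comp (measurable_const.prodMk (ma.prodMk mb))).ennreal_ofReal,
    slabSection_add (by fun_prop), slabSection_const_mul ENNReal.ofReal_ne_top,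
    slabSection_const_mul ENNReal.ofReal_ne_top, sA, sB] at key
  -- Cancelling the common weighted Hardy term in [0, ∞] requires it to be finite.
  have hkH : k * slabHardy m p α U ≠ ∞ := ENNReal.mul_ne_top ENNReal.ofReal_ne_top hH
  have hsum := hardyWeight_add (β := β) hp ht0
  have eL : ENNReal.ofReal (hardyWeight p β t) * (k * slabHardy m p α U) +
      ENNReal.ofReal (hardyWeight p β t⁻¹) *
        (ENNReal.ofReal (t ^ (α - 1)) * (k * slabHardy m p α U)) =
      ENNReal.ofReal (t ^ β + t ^ ((p - 1) * β)) * (k * slabHardy m p α U) := by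
    rw [← mul_assoc (ENNReal.ofReal (hardyWeight p β t⁻¹)), ← ENNReal.ofReal_mul hW2, ← add_mul,
      ← ENNReal.ofReal_add hW1 (by positivity), ← hsum, hβ, mul_comm (t ^ (α - 1))]
  have eR : k * slabHardy m p α U + ENNReal.ofReal (t ^ (α - 1)) * (k * slabHardy m p α U) =
      ENNReal.ofReal ((1 - t ^ β) * (1 - t ^ ((p - 1) * β))) * (k * slabHardy m p α U) +
      ENNReal.ofReal (t ^ β + t ^ ((p - 1) * β)) * (k * slabHardy m p α U) := by
    rw [← add_mul, ← ENNReal.ofReal_add hs (by positivity)]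
    have : (1 - t ^ β) * (1 - t ^ ((p - 1) * β)) + (t ^ β + t ^ ((p - 1) * β)) =
        1 + t ^ (α - 1) := by
      have : t ^ (α - 1) = t ^ β * t ^ ((p - 1) * β) := by
        rw [← Real.rpow_add ht0]; congr 1; linarith
      rw [this]; ring
    rw [this, ENNReal.ofReal_add zero_le_one (by positivity), add_mul, ENNReal.ofReal_one, one_mul]
  rw [eL, eR, ← add_assoc] at key
  have := (ENNReal.add_left_inj (ENNReal.mul_ne_top ENNReal.ofReal_ne_top hkH)).1 key
  rw [this, remainderSection, hk, ENNReal.ofReal_mul hs, ENNReal.ofReal_mul hc.le]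
  congr 1
  ac_rfl

theorem abs_hardyExponent_lt_one {p α : ℝ} (hp : 1 < p) (hα0 : 0 < α) (hα2 : α < 2) :
    |(α - 1) / p| < 1 ∧ |(p - 1) * ((α - 1) / p)| < 1 := by
  have hp0 : 0 < p := by linarith
  have h1 : |α - 1| < 1 := by rw [abs_lt]; constructor <;> linarith
  constructor
  · rw [abs_div, abs_of_pos hp0, div_lt_one hp0]
    linarith
  · rw [abs_mul, abs_div, abs_of_pos hp0, abs_of_pos (by linarith : 0 < p - 1), ← mul_div_assoc,
      div_lt_one hp0]
    nlinarith [abs_nonneg (α - 1)]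

theorem hardyFactor_nonneg {p α t : ℝ} (hp : 1 < p) (ht0 : 0 < t) (ht1 : t < 1) :
    0 ≤ (1 - t ^ ((α - 1) / p)) * (1 - t ^ ((p - 1) * ((α - 1) / p))) := by
  refine rpow_factor_nonneg ?_ ht0 ht1
  have : 0 < p - 1 := by linarith
  rw [mul_left_comm]
  exact mul_nonneg this.le (mul_self_nonneg _)

/-- The constant is `slabConst` times the integral of a nonnegative function, so `ENNReal.ofReal`
does not truncate it. At α = 1 both exponents vanish and so does the integrand, which matches the
separately assigned value 0. -/
theorem ofReal_hardyConst (m : ℕ) {p α : ℝ} (hp : 1 < p) (hα0 : 0 < α) (hα2 : α < 2) :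
    0 ≤ hardyConst (m + 1) p α ∧ ENNReal.ofReal (hardyConst (m + 1) p α) =
      (∫⁻ t in Set.Ioo (0 : ℝ) 1, ENNReal.ofReal ((1 - t ^ ((α - 1) / p)) *
        (1 - t ^ ((p - 1) * ((α - 1) / p))) * (1 - t) ^ (-1 - α))) *
        ENNReal.ofReal (slabConst m α) := by
  have hp0 : p ≠ 0 := by linarith
  by_cases h1 : α = 1
  · subst h1
    simp [hardyConst]
  · have hc := slabConst_pos m hα0
    obtain ⟨hβ, hγ⟩ := abs_hardyExponent_lt_one hp hα0 hα2
    have hα1 : α - 1 ≠ 0 := sub_ne_zero.2 h1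
    have hβ0 : (α - 1) / p ≠ 0 := div_ne_zero hα1 hp0
    have hγ0 : (p - 1) * ((α - 1) / p) ≠ 0 := mul_ne_zero (by linarith) hβ0
    have hsum : (α - 1) / p + (p - 1) * ((α - 1) / p) = α - 1 := by field_simp; ring
    have hI := integral_rpow_factor hβ hγ hα0 h1 hα2 hβ0 hγ0 hsum
    have hnn : ∀ t ∈ Set.Ioo (0 : ℝ) 1, 0 ≤ (1 - t ^ ((α - 1) / p)) *
        (1 - t ^ ((p - 1) * ((α - 1) / p))) * (1 - t) ^ (-1 - α) := fun t ht =>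
      mul_nonneg (hardyFactor_nonneg hp ht.1 ht.2)
        (Real.rpow_nonneg (by linarith [ht.2]) _)
    have hI0 := setIntegral_nonneg (μ := volume) measurableSet_Ioo hnn
    have hk : hardyConst (m + 1) p α = (∫ t in Set.Ioo (0 : ℝ) 1, (1 - t ^ ((α - 1) / p)) *
        (1 - t ^ ((p - 1) * ((α - 1) / p))) * (1 - t) ^ (-1 - α)) * slabConst m α := by
      rw [hI, hardyConst, if_neg h1, hardyConstFormula, slabConst]
      rw [show α - (α - 1) / p = (p - 1) * ((α - 1) / p) + 1 by linarith]
      push_cast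
      rw [show (m : ℝ) + 1 - 1 = m by ring, show α + ((m : ℝ) + 1) = α + m + 1 by ring]
      ring
    rw [hk]
    refine ⟨mul_nonneg hI0 hc.le, ?_⟩
    rw [ENNReal.ofReal_mul hI0, ofReal_integral_eq_lintegral_ofReal
      (integrableOn_rpow_factor hβ hγ hα2 (by linarith))]
    filter_upwards [ae_restrict_mem measurableSet_Ioo] with t ht using hnn t ht

theorem lintegral_slabSection_bregman {m : ℕ} {p α : ℝ} (hp : 1 < p) (hα0 : 0 < α) (hα2 : α < 2)
    {U : EuclideanSpace ℝ (Fin m) → ℝ → ℝ}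
    (hU : Measurable fun q : EuclideanSpace ℝ (Fin m) × ℝ => U q.1 q.2)
    (hH : slabHardy m p α U ≠ ∞) :
    ∫⁻ t in Set.Ioo (0 : ℝ) 1, slabSection m α t (fun x z w => ENNReal.ofReal
      ((U z x - U w (t * x)) * (signedPow (U z x) (p - 1) - signedPow (U w (t * x)) (p - 1)))) =
      (∫⁻ t in Set.Ioo (0 : ℝ) 1, remainderSection m p α ((α - 1) / p) t U) +
        ENNReal.ofReal (hardyConst (m + 1) p α) * slabHardy m p α U := by
  have hp0 : p ≠ 0 := by linarith
  rw [(ofReal_hardyConst m hp hα0 hα2).2, mul_assoc, ← lintegral_mul_const _ (by fun_prop),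
    ← lintegral_add_right _ (by fun_prop)]
  refine setLIntegral_congr_fun measurableSet_Ioo fun t ht => ?_
  exact slabSection_bregman hp hα0 ht.1 ht.2 (by field_simp) (hardyFactor_nonneg hp ht.1 ht.2) hU hH

/-! ### Transfer from the half-space to slab coordinates -/

/-- Appending a last coordinate, as a measurable equivalence. -/
noncomputable def snocEquiv (m : ℕ) :
    EuclideanSpace ℝ (Fin m) × ℝ ≃ᵐ EuclideanSpace ℝ (Fin (m + 1)) :=
  (((MeasurableEquiv.toLp 2 (Fin m → ℝ)).symm.prodCongr (MeasurableEquiv.refl ℝ)).trans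
    MeasurableEquiv.prodComm).trans
    ((MeasurableEquiv.piFinSuccAbove (fun _ => ℝ) (Fin.last m)).symm.trans
      (MeasurableEquiv.toLp 2 (Fin (m + 1) → ℝ)))

theorem measurePreserving_snocEquiv (m : ℕ) : MeasurePreserving (snocEquiv m) := by
  have h1 : MeasurePreserving ((MeasurableEquiv.toLp 2 (Fin m → ℝ)).symm.prodCongr
      (MeasurableEquiv.refl ℝ)) (volume.prod volume) (volume.prod volume) :=
    (EuclideanSpace.volume_preserving_symm_measurableEquiv_toLp (Fin m)).prod
      (MeasurePreserving.id volume)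
  have h2 := (volume_preserving_piFinSuccAbove (fun _ : Fin (m + 1) => ℝ) (Fin.last m)).symm
  have h3 := (EuclideanSpace.volume_preserving_symm_measurableEquiv_toLp (Fin (m + 1))).symm
  exact h3.comp (h2.comp (Measure.measurePreserving_swap.comp h1))

theorem snocEquiv_last (m : ℕ) (q : EuclideanSpace ℝ (Fin m) × ℝ) :
    snocEquiv m q (Fin.last m) = q.2 := by
  simp [snocEquiv, MeasurableEquiv.piFinSuccAbove, Fin.insertNthEquiv]
  rfl

theorem snocEquiv_castSucc (m : ℕ) (q : EuclideanSpace ℝ (Fin m) × ℝ) (i : Fin m) :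
    snocEquiv m q i.castSucc = q.1 i := by
  simp [snocEquiv, MeasurableEquiv.piFinSuccAbove, Fin.insertNthEquiv]
  rfl

theorem norm_snocEquiv_sub_sq (m : ℕ) (q r : EuclideanSpace ℝ (Fin m) × ℝ) :
    ‖snocEquiv m q - snocEquiv m r‖ ^ 2 = ‖q.1 - r.1‖ ^ 2 + (q.2 - r.2) ^ 2 := by
  rw [EuclideanSpace.norm_sq_eq, EuclideanSpace.norm_sq_eq, Fin.sum_univ_castSucc]
  simp [snocEquiv_last, snocEquiv_castSucc]

theorem lastCoord_snocEquiv (m : ℕ) (hd : 1 ≤ m + 1) (q : EuclideanSpace ℝ (Fin m) × ℝ) :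
    lastCoord hd (snocEquiv m q) = q.2 :=
  snocEquiv_last m q

theorem setLIntegral_halfSpace (m : ℕ) (hd : 1 ≤ m + 1)
    {f : EuclideanSpace ℝ (Fin (m + 1)) → ℝ≥0∞} (hf : Measurable f) :
    ∫⁻ x in halfSpace hd, f x = ∫⁻ x in Set.Ioi 0, ∫⁻ z, f (snocEquiv m (z, x)) := by
  have hm := (measurePreserving_snocEquiv m).setLIntegral_comp_preimage_emb
    (snocEquiv m).measurableEmbedding f (halfSpace hd)
  have hs : snocEquiv m ⁻¹' halfSpace hd = Set.univ ×ˢ Set.Ioi 0 := by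
    ext q
    simp [halfSpace, lastCoord_snocEquiv]
  rw [← hm, hs, Measure.volume_eq_prod, ← Measure.prod_restrict, Measure.restrict_univ,
    lintegral_prod_symm _ (by fun_prop)]

theorem ofReal_bregmanIntegrand_snocEquiv (m : ℕ) {p : ℝ} (hp : 1 < p) (α : ℝ)
    (u : EuclideanSpace ℝ (Fin (m + 1)) → ℝ) (q r : EuclideanSpace ℝ (Fin m) × ℝ) :
    ENNReal.ofReal (bregmanIntegrand p α u (snocEquiv m q) (snocEquiv m r)) =
      ENNReal.ofReal ((u (snocEquiv m q) - u (snocEquiv m r)) *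
        (signedPow (u (snocEquiv m q)) (p - 1) - signedPow (u (snocEquiv m r)) (p - 1))) *
        slabKernel m α (q.1 - r.1) (q.2 - r.2) := by
  have h0 : 0 ≤ (u (snocEquiv m q) - u (snocEquiv m r)) *
      (signedPow (u (snocEquiv m q)) (p - 1) - signedPow (u (snocEquiv m r)) (p - 1)) := by
    have hm := signedPow_monotone (sub_pos.2 hp)
    rcases le_total (u (snocEquiv m q)) (u (snocEquiv m r)) with h | h
    · exact mul_nonneg_of_nonpos_of_nonpos (sub_nonpos.2 h) (sub_nonpos.2 (hm h))
    · exact mul_nonneg (sub_nonneg.2 h) (sub_nonneg.2 (hm h))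
  rw [slabKernel, ← ENNReal.ofReal_mul h0, bregmanIntegrand, div_eq_mul_inv,
    ← norm_snocEquiv_sub_sq, ← Real.rpow_natCast ‖_‖ 2, ← Real.rpow_mul (norm_nonneg _),
    ← Real.rpow_neg (norm_nonneg _)]
  congr 3
  push_cast
  ring

theorem measurable_bregman_slab {m : ℕ} {p α : ℝ} {X : Type*} [MeasurableSpace X]
    {U : EuclideanSpace ℝ (Fin m) → ℝ → ℝ}
    (hU : Measurable fun q : EuclideanSpace ℝ (Fin m) × ℝ => U q.1 q.2)
    {z w : X → EuclideanSpace ℝ (Fin m)} {x y : X → ℝ} (hz : Measurable z) (hw : Measurable w)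
    (hx : Measurable x) (hy : Measurable y) :
    Measurable fun q => ENNReal.ofReal ((U (z q) (x q) - U (w q) (y q)) *
        (signedPow (U (z q) (x q)) (p - 1) - signedPow (U (w q) (y q)) (p - 1))) *
        slabKernel m α (z q - w q) (x q - y q) := by
  have ma : Measurable fun q => U (z q) (x q) := hU.comp (hz.prodMk hx)
  have mb : Measurable fun q => U (w q) (y q) := hU.comp (hw.prodMk hy)
  have mS := measurable_signedPow (p - 1)
  fun_prop

/-- The interaction of the hyperplanes at heights `x` and `y`. -/
noncomputable def slabInteraction (m : ℕ) (p α : ℝ) (U : EuclideanSpace ℝ (Fin m) → ℝ → ℝ)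
    (x y : ℝ) : ℝ≥0∞ :=
  ∫⁻ z, ∫⁻ w, ENNReal.ofReal ((U z x - U w y) *
    (signedPow (U z x) (p - 1) - signedPow (U w y) (p - 1))) * slabKernel m α (z - w) (x - y)

theorem measurable_slabInteraction (m : ℕ) (p α : ℝ) {U : EuclideanSpace ℝ (Fin m) → ℝ → ℝ}
    (hU : Measurable fun q : EuclideanSpace ℝ (Fin m) × ℝ => U q.1 q.2) :
    Measurable (Function.uncurry (slabInteraction m p α U)) := by
  have h1 : Measurable fun q : ((ℝ × ℝ) × EuclideanSpace ℝ (Fin m)) × EuclideanSpace ℝ (Fin m) =>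
      ENNReal.ofReal ((U q.1.2 q.1.1.1 - U q.2 q.1.1.2) *
        (signedPow (U q.1.2 q.1.1.1) (p - 1) - signedPow (U q.2 q.1.1.2) (p - 1))) *
        slabKernel m α (q.1.2 - q.2) (q.1.1.1 - q.1.1.2) :=
    measurable_bregman_slab hU measurable_fst.snd measurable_snd measurable_fst.fst.fst
      measurable_fst.fst.snd
  have h2 : Measurable fun q : (ℝ × ℝ) × EuclideanSpace ℝ (Fin m) =>
      ∫⁻ w, ENNReal.ofReal ((U q.2 q.1.1 - U w q.1.2) *
        (signedPow (U q.2 q.1.1) (p - 1) - signedPow (U w q.1.2) (p - 1))) *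
        slabKernel m α (q.2 - w) (q.1.1 - q.1.2) := h1.lintegral_prod_right'
  exact h2.lintegral_prod_right'

theorem slabInteraction_comm (m : ℕ) (p α : ℝ) {U : EuclideanSpace ℝ (Fin m) → ℝ → ℝ}
    (hU : Measurable fun q : EuclideanSpace ℝ (Fin m) × ℝ => U q.1 q.2) (x y : ℝ) :
    slabInteraction m p α U x y = slabInteraction m p α U y x := by
  have h : Measurable fun q : EuclideanSpace ℝ (Fin m) × EuclideanSpace ℝ (Fin m) =>
      ENNReal.ofReal ((U q.1 x - U q.2 y) *
        (signedPow (U q.1 x) (p - 1) - signedPow (U q.2 y) (p - 1))) *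
        slabKernel m α (q.1 - q.2) (x - y) :=
    measurable_bregman_slab hU measurable_fst measurable_snd measurable_const measurable_const
  rw [slabInteraction, slabInteraction, lintegral_lintegral_swap h.aemeasurable]
  refine lintegral_congr fun z => lintegral_congr fun w => ?_
  rw [← slabKernel_neg, ← slabKernel_neg_left, neg_sub, neg_sub]
  congr 2
  ring

theorem lintegral_halfSpace_bregmanIntegrand (m : ℕ) (hd : 1 ≤ m + 1) {p α : ℝ} (hp : 1 < p)
    {u : EuclideanSpace ℝ (Fin (m + 1)) → ℝ} (hu : Measurable u)
    {U : EuclideanSpace ℝ (Fin m) → ℝ → ℝ}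
    (hU : Measurable fun q : EuclideanSpace ℝ (Fin m) × ℝ => U q.1 q.2)
    (huU : ∀ z x, u (snocEquiv m (z, x)) = U z x) :
    ∫⁻ x in halfSpace hd, ∫⁻ y in halfSpace hd, ENNReal.ofReal (bregmanIntegrand p α u x y) =
      ∫⁻ x in Set.Ioi 0, ∫⁻ y in Set.Ioi 0, slabInteraction m p α U x y := by
  have mS := measurable_signedPow (p - 1)
  have hB : Measurable fun q : EuclideanSpace ℝ (Fin (m + 1)) × EuclideanSpace ℝ (Fin (m + 1)) =>
      ENNReal.ofReal (bregmanIntegrand p α u q.1 q.2) := by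
    unfold bregmanIntegrand
    fun_prop
  rw [setLIntegral_halfSpace m hd (Measurable.lintegral_prod_right' hB)]
  refine lintegral_congr fun x => ?_
  have : ∀ z, ∫⁻ y in halfSpace hd,
      ENNReal.ofReal (bregmanIntegrand p α u (snocEquiv m (z, x)) y) =
      ∫⁻ y in Set.Ioi 0, ∫⁻ w, ENNReal.ofReal ((U z x - U w y) *
      (signedPow (U z x) (p - 1) - signedPow (U w y) (p - 1))) *
        slabKernel m α (z - w) (x - y) := fun z => by
    have hz : Measurable fun y =>
        ENNReal.ofReal (bregmanIntegrand p α u (snocEquiv m (z, x)) y) := by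
      unfold bregmanIntegrand
      fun_prop
    rw [setLIntegral_halfSpace m hd hz]
    simp only [ofReal_bregmanIntegrand_snocEquiv m hp, huU]
  simp only [this]
  have h1 : Measurable fun q : (EuclideanSpace ℝ (Fin m) × ℝ) × EuclideanSpace ℝ (Fin m) =>
      ENNReal.ofReal ((U q.1.1 x - U q.2 q.1.2) *
        (signedPow (U q.1.1 x) (p - 1) - signedPow (U q.2 q.1.2) (p - 1))) *
        slabKernel m α (q.1.1 - q.2) (x - q.1.2) :=
    measurable_bregman_slab hU measurable_fst.fst measurable_snd measurable_const
      measurable_fst.snd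
  have h2 : Measurable fun q : EuclideanSpace ℝ (Fin m) × ℝ =>
      ∫⁻ w, ENNReal.ofReal ((U q.1 x - U w q.2) *
        (signedPow (U q.1 x) (p - 1) - signedPow (U w q.2) (p - 1))) *
        slabKernel m α (q.1 - w) (x - q.2) := h1.lintegral_prod_right'
  rw [lintegral_lintegral_swap h2.aemeasurable]
  rfl

theorem sobolevBregmanForm_halfSpace_eq (m : ℕ) (hd : 1 ≤ m + 1) {p α : ℝ} (hp : 1 < p)
    {u : EuclideanSpace ℝ (Fin (m + 1)) → ℝ} (hu : Measurable u)
    {U : EuclideanSpace ℝ (Fin m) → ℝ → ℝ}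
    (hU : Measurable fun q : EuclideanSpace ℝ (Fin m) × ℝ => U q.1 q.2)
    (huU : ∀ z x, u (snocEquiv m (z, x)) = U z x) :
    sobolevBregmanForm (halfSpace hd) p α u =
      ∫⁻ t in Set.Ioo (0 : ℝ) 1, slabSection m α t (fun x z w => ENNReal.ofReal
        ((U z x - U w (t * x)) *
          (signedPow (U z x) (p - 1) - signedPow (U w (t * x)) (p - 1)))) := by
  rw [sobolevBregmanForm, lintegral_halfSpace_bregmanIntegrand m hd hp hu hU huU,
    half_mul_lintegral_lintegral_of_symm (measurable_slabInteraction m p α hU)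
      (slabInteraction_comm m p α hU)]
  refine lintegral_congr fun t => lintegral_congr fun x => ?_
  simp only [slabInteraction, show x - t * x = x * (1 - t) by ring]

theorem hardyTerm_eq_slabHardy (m : ℕ) (hd : 1 ≤ m + 1) {p α : ℝ}
    {u : EuclideanSpace ℝ (Fin (m + 1)) → ℝ} (hu : Measurable u) :
    hardyTerm hd p α u = slabHardy m p α fun z x => u (snocEquiv m (z, x)) := by
  have hl : Measurable fun x : EuclideanSpace ℝ (Fin (m + 1)) => lastCoord hd x := by
    unfold lastCoord
    fun_prop
  rw [hardyTerm, setLIntegral_halfSpace m hd (by fun_prop), slabHardy]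
  refine setLIntegral_congr_fun measurableSet_Ioi fun x hx => ?_
  have hx : (0 : ℝ) < x := hx
  rw [← lintegral_const_mul' _ _ ENNReal.ofReal_ne_top]
  refine lintegral_congr fun z => ?_
  rw [← ENNReal.ofReal_mul (by positivity), lastCoord_snocEquiv, Real.rpow_neg hx.le,
    div_eq_mul_inv, mul_comm]

/-- The last coordinate is bounded away from 0 on the compact support. This finiteness is what the
cancellation in `slabSection_bregman` needs. -/
theorem hardyTerm_ne_top {d : ℕ} (hd : 1 ≤ d) {p α : ℝ} (hp : 1 < p)
    {u : EuclideanSpace ℝ (Fin d) → ℝ} (hu : IsCc (halfSpace hd) u) : hardyTerm hd p α u ≠ ∞ := by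
  obtain ⟨hc, hK, hs⟩ := hu
  have hK' : IsCompact (tsupport u) := hK
  have hl : Continuous fun x : EuclideanSpace ℝ (Fin d) => lastCoord hd x := by
    unfold lastCoord
    fun_prop
  have hcont : ContinuousOn (fun x => |u x| ^ p / lastCoord hd x ^ α) (tsupport u) := by
    refine ContinuousOn.div ?_ ?_ fun x hx => (Real.rpow_pos_of_pos (hs hx) α).ne'
    · exact (hc.abs.rpow_const fun x => Or.inr (by linarith)).continuousOn
    · exact hl.continuousOn.rpow_const fun x hx => Or.inl (hs hx).ne'
  have hi : IntegrableOn (fun x => |u x| ^ p / lastCoord hd x ^ α) (tsupport u) :=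
    hcont.integrableOn_compact hK'
  refine ne_top_of_le_ne_top hi.lintegral_lt_top.ne ?_
  have hD : MeasurableSet (halfSpace hd) := hl.measurable measurableSet_Ioi
  rw [hardyTerm, ← lintegral_indicator hD,
    ← lintegral_indicator hK'.isClosed.measurableSet]
  refine lintegral_mono fun x => ?_
  by_cases hx : x ∈ tsupport u
  · rw [Set.indicator_of_mem hx, Set.indicator_of_mem (hs hx)]
  · have : u x = 0 := image_eq_zero_of_notMem_tsupport hx
    refine (Set.indicator_le_self _ _ _).trans ?_
    simp [this, Real.zero_rpow (show p ≠ 0 by linarith)]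

/-- The Hardy identity: the Sobolev–Bregman form is the Hardy term plus a nonnegative remainder. -/
theorem sobolevBregmanForm_eq_remainder_add (m : ℕ) (hd : 1 ≤ m + 1) {p α : ℝ} (hp : 1 < p)
    (hα0 : 0 < α) (hα2 : α < 2) {u : EuclideanSpace ℝ (Fin (m + 1)) → ℝ}
    (hu : IsCc (halfSpace hd) u) :
    sobolevBregmanForm (halfSpace hd) p α u =
      (∫⁻ t in Set.Ioo (0 : ℝ) 1,
        remainderSection m p α ((α - 1) / p) t fun z x => u (snocEquiv m (z, x))) +
        ENNReal.ofReal (hardyConst (m + 1) p α) * hardyTerm hd p α u := by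
  have hm := hu.1.measurable
  have hH := hardyTerm_ne_top hd (α := α) hp hu
  rw [hardyTerm_eq_slabHardy m hd hm] at hH ⊢
  have hU : Measurable fun q : EuclideanSpace ℝ (Fin m) × ℝ => u (snocEquiv m (q.1, q.2)) :=
    hm.comp (snocEquiv m).measurable
  rw [sobolevBregmanForm_halfSpace_eq m hd hp hm hU fun _ _ => rfl]
  exact lintegral_slabSection_bregman hp hα0 hα2 hU hH

/-! ### Cut-off functions and their increments -/

/-- The tent function `max(0, 1 - ‖z‖)`. -/
noncomputable def tent {E : Type*} [NormedAddCommGroup E] (z : E) : ℝ :=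
  max 0 (1 - ‖z‖)

section Tent

variable {E : Type*} [NormedAddCommGroup E]

theorem continuous_tent : Continuous (tent : E → ℝ) := by
  unfold tent
  fun_prop

theorem tent_nonneg (z : E) : 0 ≤ tent z := le_max_left _ _

theorem tent_le_one (z : E) : tent z ≤ 1 :=
  max_le zero_le_one (by linarith [norm_nonneg z])

theorem tent_eq_zero {z : E} (hz : 1 ≤ ‖z‖) : tent z = 0 :=
  max_eq_left (by linarith)

theorem norm_lt_one_of_tent_ne_zero {z : E} (hz : tent z ≠ 0) : ‖z‖ < 1 := by
  by_contra h
  exact hz (tent_eq_zero (not_lt.1 h))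

theorem abs_tent_sub_le (z w : E) : |tent z - tent w| ≤ ‖z - w‖ := by
  have h := abs_max_sub_max_le_abs (1 - ‖z‖) (1 - ‖w‖) 0
  rw [max_comm, max_comm _ (0 : ℝ)] at h
  refine h.trans ?_
  rw [show 1 - ‖z‖ - (1 - ‖w‖) = -(‖z‖ - ‖w‖) by ring, abs_neg]
  exact abs_norm_sub_norm_le z w

/-- The Lipschitz bound ‖h‖² and the trivial bound 1 interpolate to ‖h‖^s. The freedom in s matters
because the second moment of the slab kernel may be infinite. -/
theorem tent_sub_sq_le {s : ℝ} (hs0 : 0 ≤ s) (hs2 : s ≤ 2) (z h : E) :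
    ENNReal.ofReal ((tent z - tent (z + h)) ^ 2) ≤
      ENNReal.ofReal (‖h‖ ^ s) * ((Metric.ball (0 : E) 1).indicator 1 z +
        (Metric.ball (0 : E) 1).indicator 1 (z + h)) := by
  have key : (tent z - tent (z + h)) ^ 2 ≤ ‖h‖ ^ s := by
    have h1 := abs_tent_sub_le z (z + h)
    rw [show z - (z + h) = -h by abel, norm_neg] at h1
    have h2 : |tent z - tent (z + h)| ≤ 1 := abs_le.2
      ⟨by linarith [tent_nonneg z, tent_le_one (z + h)],
        by linarith [tent_le_one z, tent_nonneg (z + h)]⟩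
    rw [← sq_abs]
    rcases le_total ‖h‖ 1 with hh | hh
    · calc |tent z - tent (z + h)| ^ 2 ≤ ‖h‖ ^ 2 := by gcongr
        _ = ‖h‖ ^ (2 : ℝ) := (Real.rpow_two _).symm
        _ ≤ ‖h‖ ^ s := by
          rcases (norm_nonneg h).eq_or_lt with h0 | h0
          · rw [← h0, Real.zero_rpow two_ne_zero]
            exact Real.rpow_nonneg le_rfl _
          · exact Real.rpow_le_rpow_of_exponent_ge h0 hh hs2
    · calc |tent z - tent (z + h)| ^ 2 ≤ 1 ^ 2 := by gcongr
        _ = 1 := one_pow 2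
        _ ≤ ‖h‖ ^ s := Real.one_le_rpow hh hs0
  by_cases h1 : z ∈ Metric.ball (0 : E) 1
  · rw [Set.indicator_of_mem h1]
    refine (ENNReal.ofReal_le_ofReal key).trans (le_mul_of_one_le_right' ?_)
    exact le_self_add
  · by_cases h2 : z + h ∈ Metric.ball (0 : E) 1
    · rw [Set.indicator_of_mem h2]
      refine (ENNReal.ofReal_le_ofReal key).trans (le_mul_of_one_le_right' ?_)
      exact le_add_self
    · rw [tent_eq_zero (by simpa using h1), tent_eq_zero (by simpa using h2)]
      simp

theorem lintegral_tent_sub_sq_le [MeasureSpace E] [BorelSpace E]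
    [(volume : Measure E).IsAddRightInvariant] {s : ℝ} (hs0 : 0 ≤ s) (hs2 : s ≤ 2) (h : E) :
    ∫⁻ z, ENNReal.ofReal ((tent z - tent (z + h)) ^ 2) ≤
      ENNReal.ofReal (‖h‖ ^ s) * (2 * volume (Metric.ball (0 : E) 1)) := by
  refine (lintegral_mono fun z => tent_sub_sq_le hs0 hs2 z h).trans_eq ?_
  rw [lintegral_const_mul' _ _ ENNReal.ofReal_ne_top, lintegral_add_left
    (measurable_one.indicator measurableSet_ball),
    lintegral_add_right_eq_self ((Metric.ball (0 : E) 1).indicator 1) h,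
    lintegral_indicator_one measurableSet_ball, two_mul]

theorem lintegral_tent_sq_ne_top [MeasureSpace E] [BorelSpace E] [ProperSpace E]
    [IsFiniteMeasureOnCompacts (volume : Measure E)] :
    ∫⁻ z : E, ENNReal.ofReal (tent z ^ 2) ≠ ∞ := by
  refine ne_top_of_le_ne_top (measure_ball_lt_top (μ := volume) (x := (0 : E)) (r := 1)).ne ?_
  rw [← lintegral_indicator_one measurableSet_ball]
  refine lintegral_mono fun z => ?_
  by_cases h1 : z ∈ Metric.ball (0 : E) 1
  · rw [Set.indicator_of_mem h1]
    exact ENNReal.ofReal_le_one.2 (pow_le_one₀ (tent_nonneg z) (tent_le_one z))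
  · rw [tent_eq_zero (by simpa using h1)]
    simp

theorem lintegral_tent_sq_ne_zero [MeasureSpace E] [BorelSpace E]
    [(volume : Measure E).IsOpenPosMeasure] :
    ∫⁻ z : E, ENNReal.ofReal (tent z ^ 2) ≠ 0 := by
  have hc : Continuous fun z : E => ENNReal.ofReal (tent z ^ 2) :=
    ENNReal.continuous_ofReal.comp (continuous_tent.pow 2)
  rw [Ne, lintegral_eq_zero_iff hc.measurable]
  intro h0
  have := congrFun ((hc.ae_eq_iff_eq volume continuous_zero).1 h0) 0
  simp [tent] at this

end Tent

/-- Passing to the increment w and rescaling z by R gives R^m from the volume and R^{-s} from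
‖w/R‖^s; the s-th moment of the kernel gives the power of h. -/
theorem lintegral_tent_smul_sub_sq_le {m : ℕ} {α s R h : ℝ} (hs0 : 0 ≤ s) (hs2 : s ≤ 2)
    (hR : 0 < R) (hh : 0 < h) :
    ∫⁻ z : EuclideanSpace ℝ (Fin m), ∫⁻ w : EuclideanSpace ℝ (Fin m),
        ENNReal.ofReal ((tent (R⁻¹ • z) - tent (R⁻¹ • w)) ^ 2) * slabKernel m α (z - w) h ≤
      ENNReal.ofReal (R ^ (m - s) * h ^ (s - 1 - α)) *
        (2 * volume (Metric.ball (0 : EuclideanSpace ℝ (Fin m)) 1) * slabMoment m α s) := by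
  have mt : Measurable (tent : EuclideanSpace ℝ (Fin m) → ℝ) := continuous_tent.measurable
  calc ∫⁻ z : EuclideanSpace ℝ (Fin m), ∫⁻ w : EuclideanSpace ℝ (Fin m),
        ENNReal.ofReal ((tent (R⁻¹ • z) - tent (R⁻¹ • w)) ^ 2) * slabKernel m α (z - w) h
      = ∫⁻ z : EuclideanSpace ℝ (Fin m), ∫⁻ w : EuclideanSpace ℝ (Fin m),
        ENNReal.ofReal ((tent (R⁻¹ • z) - tent (R⁻¹ • (z + w))) ^ 2) * slabKernel m α w h := by
        refine lintegral_congr fun z => ?_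
        rw [← lintegral_add_left_eq_self _ z]
        refine lintegral_congr fun w => ?_
        rw [sub_add_cancel_left, slabKernel_neg_left]
    _ = ∫⁻ w : EuclideanSpace ℝ (Fin m), (∫⁻ z : EuclideanSpace ℝ (Fin m),
        ENNReal.ofReal ((tent (R⁻¹ • z) - tent (R⁻¹ • z + R⁻¹ • w)) ^ 2)) *
          slabKernel m α w h := by
        rw [lintegral_lintegral_swap (Measurable.aemeasurable (by fun_prop))]
        refine lintegral_congr fun w => ?_
        rw [lintegral_mul_const _ (by fun_prop)]
        simp only [smul_add]
    _ ≤ ∫⁻ w : EuclideanSpace ℝ (Fin m), ENNReal.ofReal (R ^ (m - s)) *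
        (2 * volume (Metric.ball (0 : EuclideanSpace ℝ (Fin m)) 1)) *
          (ENNReal.ofReal (‖w‖ ^ s) * slabKernel m α w h) := by
        refine lintegral_mono fun w => ?_
        rw [lintegral_comp_smul_addHaar (inv_ne_zero hR.ne')
          (fun z => ENNReal.ofReal ((tent z - tent (z + R⁻¹ • w)) ^ 2))]
        calc _ ≤ ENNReal.ofReal |((R⁻¹) ^ m)⁻¹| * (ENNReal.ofReal (‖R⁻¹ • w‖ ^ s) *
              (2 * volume (Metric.ball (0 : EuclideanSpace ℝ (Fin m)) 1))) *
              slabKernel m α w h := by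
              gcongr
              exact lintegral_tent_sub_sq_le hs0 hs2 _
          _ = ENNReal.ofReal (|((R⁻¹) ^ m)⁻¹| * ‖R⁻¹ • w‖ ^ s) *
              (2 * volume (Metric.ball (0 : EuclideanSpace ℝ (Fin m)) 1)) *
              slabKernel m α w h := by
              rw [ENNReal.ofReal_mul (abs_nonneg _)]
              ring
          _ = ENNReal.ofReal (R ^ (m - s) * ‖w‖ ^ s) *
              (2 * volume (Metric.ball (0 : EuclideanSpace ℝ (Fin m)) 1)) *
              slabKernel m α w h := by
              congr 3
              rw [norm_smul, norm_inv, Real.norm_of_nonneg hR.le, inv_pow, inv_inv,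
                abs_of_pos (by positivity), Real.mul_rpow (by positivity) (norm_nonneg _),
                Real.inv_rpow hR.le, Real.rpow_sub hR, Real.rpow_natCast]
              ring
          _ = _ := by
              rw [ENNReal.ofReal_mul (by positivity)]
              ring
    _ = _ := by
        have hB : volume (Metric.ball (0 : EuclideanSpace ℝ (Fin m)) 1) ≠ ∞ :=
          measure_ball_lt_top.ne
        rw [lintegral_const_mul' _ _ (ENNReal.mul_ne_top ENNReal.ofReal_ne_top
          (ENNReal.mul_ne_top (by norm_num) hB)), lintegral_norm_rpow_mul_slabKernel m α s hh,
          ENNReal.ofReal_mul (by positivity)]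
        ring

theorem lintegral_tent_smul_sq (m : ℕ) {R : ℝ} (hR : 0 < R) :
    ∫⁻ z : EuclideanSpace ℝ (Fin m), ENNReal.ofReal (tent (R⁻¹ • z) ^ 2) =
      ENNReal.ofReal (R ^ m) *
        ∫⁻ z : EuclideanSpace ℝ (Fin m), ENNReal.ofReal (tent z ^ 2) := by
  rw [lintegral_comp_smul_addHaar (inv_ne_zero hR.ne') (fun z => ENNReal.ofReal (tent z ^ 2)),
    inv_pow, inv_inv, abs_of_pos (by positivity)]

theorem lintegral_inv_mul_comp_log (g : ℝ → ℝ≥0∞) :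
    ∫⁻ x in Set.Ioi (0 : ℝ), ENNReal.ofReal x⁻¹ * g (Real.log x) = ∫⁻ r, g r := by
  have h := lintegral_image_eq_lintegral_abs_deriv_mul (s := Set.univ) (f := Real.exp)
    (f' := Real.exp) MeasurableSet.univ (fun x _ => (Real.hasDerivAt_exp x).hasDerivWithinAt)
    Real.exp_injective.injOn (fun x => ENNReal.ofReal x⁻¹ * g (Real.log x))
  rw [Set.image_univ, Real.range_exp, Measure.restrict_univ] at h
  rw [h]
  refine lintegral_congr fun r => ?_
  have := Real.exp_pos r
  rw [Real.log_exp, ← mul_assoc, ← ENNReal.ofReal_mul (abs_nonneg _), abs_of_pos this,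
    mul_inv_cancel₀ this.ne', ENNReal.ofReal_one, one_mul]

/-- The logarithmic cut-off on `(0, ∞)`, supported on `[e^{-2n}, 1]`. -/
noncomputable def logTent (n x : ℝ) : ℝ :=
  tent (Real.log x / n + 1)

theorem lintegral_inv_mul_comp_log_div {n : ℝ} (hn : 0 < n) (g : ℝ → ℝ≥0∞) :
    ∫⁻ x in Set.Ioi (0 : ℝ), ENNReal.ofReal x⁻¹ * g (Real.log x / n + 1) =
      ENNReal.ofReal n * ∫⁻ r, g r := by
  rw [lintegral_inv_mul_comp_log (fun r => g (r / n + 1)),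
    ← ofReal_mul_lintegral_comp_mul_left hn (fun r => g (r / n + 1))]
  simp only [mul_div_cancel_left₀ _ hn.ne']
  rw [lintegral_add_right_eq_self g]

theorem lintegral_logTent_sq {n : ℝ} (hn : 0 < n) :
    ∫⁻ x in Set.Ioi (0 : ℝ), ENNReal.ofReal x⁻¹ * ENNReal.ofReal (logTent n x ^ 2) =
      ENNReal.ofReal n * ∫⁻ r : ℝ, ENNReal.ofReal (tent r ^ 2) :=
  lintegral_inv_mul_comp_log_div hn fun r => ENNReal.ofReal (tent r ^ 2)

/-- In the variable log x / n + 1, dilation by t becomes translation by log t / n. The squared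
increment gains n^{-2} against the length n. -/
theorem lintegral_logTent_sub_sq_le {n t : ℝ} (hn : 0 < n) (ht : 0 < t) :
    ∫⁻ x in Set.Ioi (0 : ℝ), ENNReal.ofReal x⁻¹ *
        ENNReal.ofReal ((logTent n x - logTent n (t * x)) ^ 2) ≤
      ENNReal.ofReal (n⁻¹ * Real.log t ^ 2) * (2 * volume (Metric.ball (0 : ℝ) 1)) := by
  have h1 : ∫⁻ x in Set.Ioi (0 : ℝ), ENNReal.ofReal x⁻¹ *
        ENNReal.ofReal ((logTent n x - logTent n (t * x)) ^ 2) =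
      ENNReal.ofReal n * ∫⁻ r : ℝ, ENNReal.ofReal ((tent r - tent (r + Real.log t / n)) ^ 2) := by
    rw [← lintegral_inv_mul_comp_log_div hn]
    refine setLIntegral_congr_fun measurableSet_Ioi fun x hx => ?_
    have hx : (0 : ℝ) < x := hx
    simp only [logTent]
    rw [Real.log_mul ht.ne' hx.ne', show (Real.log t + Real.log x) / n + 1 =
      Real.log x / n + 1 + Real.log t / n by ring]
  rw [h1]
  calc _ ≤ ENNReal.ofReal n * (ENNReal.ofReal (‖Real.log t / n‖ ^ (2 : ℝ)) *
        (2 * volume (Metric.ball (0 : ℝ) 1))) := by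
        gcongr
        exact lintegral_tent_sub_sq_le zero_le_two le_rfl _
    _ = _ := by
        rw [← mul_assoc, ← ENNReal.ofReal_mul hn.le]
        congr 2
        rw [Real.rpow_two, Real.norm_eq_abs, sq_abs]
        field_simp

/-- From log y ≤ y - 1 at y = t^{-δ}. The bound keeps the double zero at t = 1, at the price of a
small negative power of t at 0. -/
theorem log_sq_le {δ t : ℝ} (hδ0 : 0 < δ) (hδ1 : δ ≤ 1) (ht0 : 0 < t) (ht1 : t < 1) :
    Real.log t ^ 2 ≤ (δ⁻¹) ^ 2 * (t ^ (-(2 * δ)) * (1 - t) ^ 2) := by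
  have hr : 0 < t ^ δ := Real.rpow_pos_of_pos ht0 δ
  have h1 : t ≤ t ^ δ := by
    simpa using Real.rpow_le_rpow_of_exponent_ge ht0 ht1.le hδ1
  have h2 : -(δ * Real.log t) ≤ (1 - t ^ δ) / t ^ δ := by
    have := Real.log_le_sub_one_of_pos (inv_pos.2 hr)
    rw [Real.log_inv, Real.log_rpow ht0] at this
    rw [sub_div, div_self hr.ne', one_div]
    exact this
  have h3 : (1 - t ^ δ) / t ^ δ ≤ (1 - t) / t ^ δ := by gcongr
  have h4 : 0 ≤ -Real.log t := by linarith [Real.log_nonpos ht0.le ht1.le]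
  have h5 : -Real.log t ≤ δ⁻¹ * ((1 - t) / t ^ δ) := by
    rw [inv_mul_eq_div, le_div_iff₀ hδ0]
    linarith
  calc Real.log t ^ 2 = (-Real.log t) ^ 2 := (neg_sq _).symm
    _ ≤ (δ⁻¹ * ((1 - t) / t ^ δ)) ^ 2 := by gcongr
    _ = _ := by
      rw [show -(2 * δ) = -(δ * 2) by ring, Real.rpow_neg ht0.le, Real.rpow_mul ht0.le,
        Real.rpow_two]
      field_simp

theorem lintegral_rpow_mul_log_sq_ne_top {a α : ℝ} (ha : |a| < 1) (hα : α < 2) :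
    ∫⁻ t in Set.Ioo (0 : ℝ) 1,
      ENNReal.ofReal (t ^ a * ((1 - t) ^ (-1 - α) * Real.log t ^ 2)) ≠ ∞ := by
  obtain ⟨h1, h2⟩ := abs_lt.1 ha
  -- Spends half of the distance from a to -1: a - 2δ = (a - 1)/2 > -1.
  set δ := (1 + a) / 4 with hδ
  have hδ0 : 0 < δ := by linarith
  have hf := lintegral_rpow_mul_one_sub_rpow_ne_top (a := a - 2 * δ) (b := 1 - α) (by linarith)
    (by linarith)
  refine ne_top_of_le_ne_top (ENNReal.mul_ne_top (ENNReal.ofReal_ne_top (r := (δ⁻¹) ^ 2)) hf) ?_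
  rw [← lintegral_const_mul' _ _ ENNReal.ofReal_ne_top]
  refine setLIntegral_mono' measurableSet_Ioo fun t ht => ?_
  have ht0 := ht.1
  have ht1 : 0 < 1 - t := by linarith [ht.2]
  rw [← ENNReal.ofReal_mul (by positivity)]
  apply ENNReal.ofReal_le_ofReal
  have e1 : t ^ (a - 2 * δ) = t ^ a * t ^ (-(2 * δ)) := by
    rw [← Real.rpow_add ht0]; congr 1
  have e2 : (1 - t) ^ (1 - α) = (1 - t) ^ (-1 - α) * (1 - t) ^ 2 := by
    rw [← Real.rpow_two, ← Real.rpow_add ht1]; congr 1; ring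
  calc t ^ a * ((1 - t) ^ (-1 - α) * Real.log t ^ 2)
      ≤ t ^ a * ((1 - t) ^ (-1 - α) * ((δ⁻¹) ^ 2 * (t ^ (-(2 * δ)) * (1 - t) ^ 2))) := by
        gcongr
        exact log_sq_le hδ0 (by linarith) ht0 ht.2
    _ = _ := by rw [e1, e2]; ring

theorem logTent_nonneg (n x : ℝ) : 0 ≤ logTent n x := tent_nonneg _

theorem mem_Ioo_of_logTent_ne_zero {n x : ℝ} (hn : 0 < n) (hx : 0 < x) (h : logTent n x ≠ 0) :
    Real.exp (-2 * n) < x ∧ x < 1 := by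
  have h1 := norm_lt_one_of_tent_ne_zero h
  rw [Real.norm_eq_abs, abs_lt] at h1
  constructor
  · rw [← Real.lt_log_iff_exp_lt hx, ← lt_div_iff₀ hn]
    linarith [h1.1]
  · rw [← Real.log_neg_iff hx]
    have : Real.log x / n < 0 := by linarith [h1.2]
    by_contra hc
    exact absurd this (not_lt.2 (div_nonneg (not_lt.1 hc) hn.le))

theorem measurable_logTent (n : ℝ) : Measurable (logTent n) := by
  have : Measurable (tent : ℝ → ℝ) := continuous_tent.measurable
  unfold logTent
  fun_prop

/-! ### The test functions: remainder and Hardy term -/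

/-- The powers of x combine to x^{s-1}, which is at most x^{-1} since the cut-off lives on x < 1;
what is left is the logarithmic integral of the cut-off. -/
theorem slabSection_tangential_le {m : ℕ} {α s n t : ℝ} (hs0 : 0 ≤ s) (hs2 : s ≤ 2) (hn : 0 < n)
    (ht1 : t < 1) :
    slabSection m α t (fun x z w => ENNReal.ofReal (x ^ (α - 1) * logTent n x ^ 2) *
      ENNReal.ofReal ((tent (n⁻¹ • z) - tent (n⁻¹ • w)) ^ 2)) ≤
      ENNReal.ofReal (n ^ (m - s) * (1 - t) ^ (s - 1 - α)) *
        (2 * volume (Metric.ball (0 : EuclideanSpace ℝ (Fin m)) 1) * slabMoment m α s) *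
        (ENNReal.ofReal n * ∫⁻ r : ℝ, ENNReal.ofReal (tent r ^ 2)) := by
  have h1 : 0 < 1 - t := by linarith
  have mT := measurable_logTent n
  rw [← lintegral_logTent_sq hn, ← lintegral_const_mul _ (by fun_prop), slabSection]
  refine setLIntegral_mono' measurableSet_Ioi fun x hx => ?_
  have hx : (0 : ℝ) < x := hx
  simp only [mul_assoc (ENNReal.ofReal (x ^ (α - 1) * logTent n x ^ 2)),
    lintegral_const_mul' _ _ ENNReal.ofReal_ne_top]
  set C := 2 * volume (Metric.ball (0 : EuclideanSpace ℝ (Fin m)) 1) * slabMoment m α s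
  calc _ ≤ ENNReal.ofReal x * (ENNReal.ofReal (x ^ (α - 1) * logTent n x ^ 2) *
        (ENNReal.ofReal (n ^ (m - s) * (x * (1 - t)) ^ (s - 1 - α)) * C)) := by
        gcongr
        exact lintegral_tent_smul_sub_sq_le hs0 hs2 hn (mul_pos hx h1)
    _ = ENNReal.ofReal (x * (x ^ (α - 1) * logTent n x ^ 2) *
        (n ^ (m - s) * (x * (1 - t)) ^ (s - 1 - α))) * C := by
        rw [ENNReal.ofReal_mul (p := x * _) (by positivity), ENNReal.ofReal_mul hx.le]
        ring
    _ ≤ ENNReal.ofReal (n ^ (m - s) * (1 - t) ^ (s - 1 - α) * (x⁻¹ * logTent n x ^ 2)) * C := by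
        gcongr ENNReal.ofReal ?_ * C
        by_cases h0 : logTent n x = 0
        · simp [h0]
        · have hx1 := (mem_Ioo_of_logTent_ne_zero hn hx h0).2
          rw [Real.mul_rpow hx.le h1.le]
          have e : x * x ^ (α - 1) * x ^ (s - 1 - α) ≤ x⁻¹ := by
            have e' : x * x ^ (α - 1) * x ^ (s - 1 - α) = x ^ (s - 1) := by
              have e1 := Real.rpow_add hx 1 (α - 1)
              rw [Real.rpow_one] at e1
              rw [← e1, ← Real.rpow_add hx]
              congr 1
              ring
            rw [e', ← Real.rpow_neg_one]
            exact Real.rpow_le_rpow_of_exponent_ge hx hx1.le (by linarith)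
          calc x * (x ^ (α - 1) * logTent n x ^ 2) *
                (n ^ (m - s) * (x ^ (s - 1 - α) * (1 - t) ^ (s - 1 - α)))
              = n ^ (m - s) * (1 - t) ^ (s - 1 - α) *
                ((x * x ^ (α - 1) * x ^ (s - 1 - α)) * logTent n x ^ 2) := by ring
            _ ≤ _ := by gcongr
    _ = _ := by
        rw [ENNReal.ofReal_mul (p := n ^ (m - s) * _) (by positivity),
          ENNReal.ofReal_mul (p := x⁻¹) (by positivity)]
        ring

theorem slabSection_normal_le {m : ℕ} {α n t : ℝ} (hα : 0 < α) (hn : 0 < n) (ht0 : 0 < t)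
    (ht1 : t < 1) :
    slabSection m α t (fun x _ w =>
      ENNReal.ofReal (x ^ (α - 1) * (logTent n x - logTent n (t * x)) ^ 2) *
      ENNReal.ofReal (tent (n⁻¹ • w) ^ 2)) ≤
      ENNReal.ofReal (slabConst m α * (1 - t) ^ (-1 - α)) *
        ((ENNReal.ofReal (n⁻¹ * Real.log t ^ 2) * (2 * volume (Metric.ball (0 : ℝ) 1))) *
        (ENNReal.ofReal (n ^ m) *
          ∫⁻ z : EuclideanSpace ℝ (Fin m), ENNReal.ofReal (tent z ^ 2))) := by
  have mt : Measurable (tent : EuclideanSpace ℝ (Fin m) → ℝ) := continuous_tent.measurable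
  have mT := measurable_logTent n
  rw [slabSection_right hα ht1 (g := fun x w =>
    ENNReal.ofReal (x ^ (α - 1) * (logTent n x - logTent n (t * x)) ^ 2) *
      ENNReal.ofReal (tent (n⁻¹ • w) ^ 2)) (fun x => by fun_prop)]
  simp only [lintegral_const_mul' _ _ ENNReal.ofReal_ne_top, lintegral_tent_smul_sq m hn]
  simp only [← mul_assoc (ENNReal.ofReal (_ ^ (-α)))]
  rw [lintegral_mul_const _ (by fun_prop)]
  refine mul_le_mul' le_rfl (mul_le_mul' ?_ le_rfl)
  refine le_trans (le_of_eq ?_) (lintegral_logTent_sub_sq_le hn ht0)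
  refine setLIntegral_congr_fun measurableSet_Ioi fun x hx => ?_
  have hx : (0 : ℝ) < x := hx
  rw [← ENNReal.ofReal_mul (by positivity), ← ENNReal.ofReal_mul (by positivity), ← mul_assoc,
    ← Real.rpow_add hx, show -α + (α - 1) = -1 by ring, Real.rpow_neg_one]

/-- After `youngDefect_le`, the increment aS - bT of the product cut-off splits as S(a - b) + b(S -
T), a tangential and a normal part. The prefactor n^m · n is the size of the Hardy term. -/
theorem remainderSection_le {m : ℕ} {p α β s n t : ℝ} (hp : 1 < p) (hα : 0 < α)
    (hβ : p * β = α - 1) (hs0 : 0 ≤ s) (hs2 : s ≤ 2) (hn : 0 < n) (ht0 : 0 < t) (ht1 : t < 1)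
    {U : EuclideanSpace ℝ (Fin m) → ℝ → ℝ}
    (hU : ∀ z x, 0 < x → U z x = x ^ β * (tent (n⁻¹ • z) * logTent n x) ^ (2 / p)) :
    remainderSection m p α β t U ≤ ENNReal.ofReal (n ^ m * n) *
      (ENNReal.ofReal (n ^ (-s)) *
        ((2 * volume (Metric.ball (0 : EuclideanSpace ℝ (Fin m)) 1) * slabMoment m α s) *
          ∫⁻ r : ℝ, ENNReal.ofReal (tent r ^ 2)) *
        ENNReal.ofReal (2 * (t ^ β + t ^ ((p - 1) * β)) * (1 - t) ^ (s - 1 - α)) +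
      ENNReal.ofReal (n ^ (-2 : ℝ)) *
        (ENNReal.ofReal (slabConst m α) * (2 * volume (Metric.ball (0 : ℝ) 1)) *
          ∫⁻ z : EuclideanSpace ℝ (Fin m), ENNReal.ofReal (tent z ^ 2)) *
        ENNReal.ofReal (2 * (t ^ β + t ^ ((p - 1) * β)) *
          ((1 - t) ^ (-1 - α) * Real.log t ^ 2))) := by
  have h1 : 0 < 1 - t := by linarith
  have hc := slabConst_pos m hα
  have mt : Measurable (tent : EuclideanSpace ℝ (Fin m) → ℝ) := continuous_tent.measurable
  have mT := measurable_logTent n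
  set ρ := 2 * (t ^ β + t ^ ((p - 1) * β)) with hρ
  have hρ0 : 0 ≤ ρ := by positivity
  calc remainderSection m p α β t U
      ≤ slabSection m α t (fun x z w => ENNReal.ofReal ρ *
        (ENNReal.ofReal (x ^ (α - 1) * logTent n x ^ 2) *
          ENNReal.ofReal ((tent (n⁻¹ • z) - tent (n⁻¹ • w)) ^ 2) +
        ENNReal.ofReal (x ^ (α - 1) * (logTent n x - logTent n (t * x)) ^ 2) *
          ENNReal.ofReal (tent (n⁻¹ • w) ^ 2))) := by
        refine slabSection_mono fun x hx z w => ?_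
        have hxα : 0 < x ^ (α - 1) := Real.rpow_pos_of_pos hx _
        rw [hU z x hx, hU w _ (mul_pos ht0 hx), ← ENNReal.ofReal_mul (by positivity),
          ← ENNReal.ofReal_mul (by positivity), ← ENNReal.ofReal_add (by positivity) (by positivity),
          ← ENNReal.ofReal_mul hρ0]
        refine ENNReal.ofReal_le_ofReal ((youngDefect_le hp ht0 hx
          (mul_nonneg (tent_nonneg _) (logTent_nonneg n x))
          (mul_nonneg (tent_nonneg _) (logTent_nonneg n (t * x)))).trans ?_)
        rw [hβ]
        generalize tent (n⁻¹ • z) = a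
        generalize tent (n⁻¹ • w) = b
        generalize logTent n x = S
        generalize logTent n (t * x) = T
        have key : (a * S - b * T) ^ 2 ≤ 2 * (S ^ 2 * (a - b) ^ 2 + (S - T) ^ 2 * b ^ 2) := by
          nlinarith [sq_nonneg (S * (a - b) - b * (S - T))]
        calc x ^ (α - 1) * (t ^ β + t ^ ((p - 1) * β)) * (a * S - b * T) ^ 2
            ≤ x ^ (α - 1) * (t ^ β + t ^ ((p - 1) * β)) *
              (2 * (S ^ 2 * (a - b) ^ 2 + (S - T) ^ 2 * b ^ 2)) := by gcongr
          _ = _ := by rw [hρ]; ring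
    _ = ENNReal.ofReal ρ * (slabSection m α t (fun x z w =>
          ENNReal.ofReal (x ^ (α - 1) * logTent n x ^ 2) *
          ENNReal.ofReal ((tent (n⁻¹ • z) - tent (n⁻¹ • w)) ^ 2)) +
        slabSection m α t (fun x _ w =>
          ENNReal.ofReal (x ^ (α - 1) * (logTent n x - logTent n (t * x)) ^ 2) *
          ENNReal.ofReal (tent (n⁻¹ • w) ^ 2))) := by
        rw [slabSection_const_mul ENNReal.ofReal_ne_top, slabSection_add (by fun_prop)]
    _ ≤ _ := mul_le_mul' le_rfl (add_le_add (slabSection_tangential_le hs0 hs2 hn ht1)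
        (slabSection_normal_le hα hn ht0 ht1))
    _ = _ := by
        rw [mul_add, mul_add]
        have e1 : ENNReal.ofReal ρ * (ENNReal.ofReal (n ^ (m - s) * (1 - t) ^ (s - 1 - α)) *
            ENNReal.ofReal n) = ENNReal.ofReal (n ^ m * n) * (ENNReal.ofReal (n ^ (-s)) *
            ENNReal.ofReal (ρ * (1 - t) ^ (s - 1 - α))) := by
          rw [← ENNReal.ofReal_mul (by positivity), ← ENNReal.ofReal_mul hρ0,
            ← ENNReal.ofReal_mul (by positivity), ← ENNReal.ofReal_mul (by positivity)]
          congr 1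
          rw [sub_eq_add_neg, Real.rpow_add hn, Real.rpow_natCast]
          ring
        have e2 : ENNReal.ofReal ρ * (ENNReal.ofReal (slabConst m α * (1 - t) ^ (-1 - α)) *
            (ENNReal.ofReal (n⁻¹ * Real.log t ^ 2) * ENNReal.ofReal (n ^ m))) =
            ENNReal.ofReal (n ^ m * n) * (ENNReal.ofReal (n ^ (-2 : ℝ)) *
            (ENNReal.ofReal (slabConst m α) *
              ENNReal.ofReal (ρ * ((1 - t) ^ (-1 - α) * Real.log t ^ 2)))) := by
          rw [← ENNReal.ofReal_mul (by positivity), ← ENNReal.ofReal_mul (by positivity),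
            ← ENNReal.ofReal_mul hρ0, ← ENNReal.ofReal_mul hc.le,
            ← ENNReal.ofReal_mul (by positivity), ← ENNReal.ofReal_mul (by positivity)]
          congr 1
          rw [Real.rpow_neg hn.le, Real.rpow_two]
          field_simp
        congr 1
        · calc _ = ENNReal.ofReal ρ * (ENNReal.ofReal (n ^ (m - s) * (1 - t) ^ (s - 1 - α)) *
                ENNReal.ofReal n) * ((2 * volume (Metric.ball (0 : EuclideanSpace ℝ (Fin m)) 1) *
                slabMoment m α s) * ∫⁻ r : ℝ, ENNReal.ofReal (tent r ^ 2)) := by ring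
            _ = _ := by rw [e1]; ring
        · calc _ = ENNReal.ofReal ρ * (ENNReal.ofReal (slabConst m α * (1 - t) ^ (-1 - α)) *
                (ENNReal.ofReal (n⁻¹ * Real.log t ^ 2) * ENNReal.ofReal (n ^ m))) *
                ((2 * volume (Metric.ball (0 : ℝ) 1)) *
                ∫⁻ z : EuclideanSpace ℝ (Fin m), ENNReal.ofReal (tent z ^ 2)) := by ring
            _ = _ := by rw [e2]; ring

/-- The ground state is critical: x^{-α} x^{pβ} = x^{-1}, so the heights contribute a logarithmic
length of order n, and z a volume of order n^m. -/
theorem slabHardy_test {m : ℕ} {p α β n : ℝ} (hp : 1 < p) (hβ : p * β = α - 1) (hn : 0 < n)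
    {U : EuclideanSpace ℝ (Fin m) → ℝ → ℝ}
    (hU : ∀ z x, 0 < x → U z x = x ^ β * (tent (n⁻¹ • z) * logTent n x) ^ (2 / p)) :
    slabHardy m p α U = ENNReal.ofReal (n ^ m * n) *
      ((∫⁻ z : EuclideanSpace ℝ (Fin m), ENNReal.ofReal (tent z ^ 2)) *
        ∫⁻ r : ℝ, ENNReal.ofReal (tent r ^ 2)) := by
  have mt : Measurable (tent : EuclideanSpace ℝ (Fin m) → ℝ) := continuous_tent.measurable
  have mT := measurable_logTent n
  have hp0 : p ≠ 0 := by linarith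
  calc slabHardy m p α U = ∫⁻ x in Set.Ioi 0, (ENNReal.ofReal x⁻¹ *
        ENNReal.ofReal (logTent n x ^ 2)) *
        (ENNReal.ofReal (n ^ m) * ∫⁻ z : EuclideanSpace ℝ (Fin m), ENNReal.ofReal (tent z ^ 2)) := by
        refine setLIntegral_congr_fun measurableSet_Ioi fun x hx => ?_
        have hx : (0 : ℝ) < x := hx
        rw [← lintegral_tent_smul_sq m hn, ← lintegral_const_mul' _ _ ENNReal.ofReal_ne_top,
          ← ENNReal.ofReal_mul (by positivity),
          ← lintegral_const_mul' _ _ ENNReal.ofReal_ne_top]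
        refine lintegral_congr fun z => ?_
        have h1 := tent_nonneg (n⁻¹ • z)
        have h2 := logTent_nonneg n x
        rw [← ENNReal.ofReal_mul (by positivity), ← ENNReal.ofReal_mul (by positivity),
          hU z x hx, abs_of_nonneg (by positivity), Real.mul_rpow (by positivity) (by positivity),
          ← Real.rpow_mul hx.le, ← Real.rpow_mul (by positivity), mul_comm β p, hβ, ← mul_assoc,
          ← Real.rpow_add hx, show -α + (α - 1) = -1 by ring, Real.rpow_neg_one,
          div_mul_cancel₀ _ hp0, Real.rpow_two]
        congr 1
        ring
    _ = _ := by
        rw [lintegral_mul_const _ (by fun_prop), lintegral_logTent_sq hn,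
          ENNReal.ofReal_mul (by positivity)]
        ring

/-- The test functions for the sharpness of the Hardy constant. -/
noncomputable def hardyTest (m : ℕ) (p β n : ℝ) (x : EuclideanSpace ℝ (Fin (m + 1))) : ℝ :=
  max (x (Fin.last m)) (Real.exp (-2 * n)) ^ β *
    (tent (n⁻¹ • WithLp.toLp 2 fun i : Fin m => x i.castSucc) *
      logTent n (max (x (Fin.last m)) (Real.exp (-2 * n)))) ^ (2 / p)

/-- Truncating the height at e^{-2n} keeps the logarithm and the power continuous on all of ℝ^d. It
changes nothing for x > 0, since the cut-off vanishes at heights in (0, e^{-2n}]. -/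
theorem hardyTest_snocEquiv {m : ℕ} {p β n : ℝ} (hp : 1 < p) (hn : 0 < n)
    (z : EuclideanSpace ℝ (Fin m)) {x : ℝ} (hx : 0 < x) :
    hardyTest m p β n (snocEquiv m (z, x)) =
      x ^ β * (tent (n⁻¹ • z) * logTent n x) ^ (2 / p) := by
  have hz : (WithLp.toLp 2 fun i : Fin m => snocEquiv m (z, x) i.castSucc) = z := by
    ext i
    simp [snocEquiv_castSucc]
  rw [hardyTest, hz, snocEquiv_last]
  rcases le_total (Real.exp (-2 * n)) x with h | h
  · rw [max_eq_left h]
  · have hp2 : 2 / p ≠ 0 := div_ne_zero two_ne_zero (by linarith)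
    have h1 : logTent n x = 0 := by
      by_contra h0
      exact absurd (mem_Ioo_of_logTent_ne_zero hn hx h0).1 (not_lt.2 h)
    have h2 : logTent n (Real.exp (-2 * n)) = 0 := by
      by_contra h0
      exact absurd (mem_Ioo_of_logTent_ne_zero hn (Real.exp_pos _) h0).1 (lt_irrefl _)
    rw [max_eq_right h, h1, h2]
    simp [Real.zero_rpow hp2]

theorem isCc_hardyTest {m : ℕ} (hd : 1 ≤ m + 1) {p β n : ℝ} (hp : 1 < p) (hn : 0 < n) :
    IsCc (halfSpace hd) (hardyTest m p β n) := by
  have hp2 : 0 < 2 / p := div_pos two_pos (by linarith)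
  have hε := Real.exp_pos (-2 * n)
  let I : EuclideanSpace ℝ (Fin (m + 1)) → EuclideanSpace ℝ (Fin m) :=
    fun x => WithLp.toLp 2 fun i : Fin m => x i.castSucc
  have hI : Continuous I := by fun_prop
  have hM : ∀ x : EuclideanSpace ℝ (Fin (m + 1)),
      0 < max (x (Fin.last m)) (Real.exp (-2 * n)) := fun x => lt_max_of_lt_right hε
  have hMc : Continuous fun x : EuclideanSpace ℝ (Fin (m + 1)) =>
      max (x (Fin.last m)) (Real.exp (-2 * n)) := by fun_prop
  let S : Set (EuclideanSpace ℝ (Fin (m + 1))) :=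
    {x | ‖I x‖ ≤ n} ∩ {x | Real.exp (-2 * n) ≤ x (Fin.last m)} ∩ {x | x (Fin.last m) ≤ 1}
  have hSc : IsClosed S := ((isClosed_le hI.norm continuous_const).inter
    (isClosed_le continuous_const (by fun_prop))).inter
    (isClosed_le (by fun_prop) continuous_const)
  have hSb : S ⊆ Metric.closedBall 0 (n + 1) := by
    rintro x ⟨⟨h1, h2⟩, h3⟩
    have h1 : ‖I x‖ ≤ n := h1
    have h2 : Real.exp (-2 * n) ≤ x (Fin.last m) := h2
    have h3 : x (Fin.last m) ≤ 1 := h3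
    rw [mem_closedBall_zero_iff]
    refine abs_le_of_sq_le_sq' ?_ (by linarith) |>.2
    have e : ‖x‖ ^ 2 = ‖I x‖ ^ 2 + x (Fin.last m) ^ 2 := by
      rw [EuclideanSpace.norm_sq_eq, EuclideanSpace.norm_sq_eq, Fin.sum_univ_castSucc]
      simp [I]
    rw [e]
    have := norm_nonneg (I x)
    nlinarith
  have hSK : IsCompact S := (isCompact_closedBall _ _).of_isClosed_subset hSc hSb
  have hsupp : Function.support (hardyTest m p β n) ⊆ S := by
    intro x hx
    have h0 : tent (n⁻¹ • I x) * logTent n (max (x (Fin.last m)) (Real.exp (-2 * n))) ≠ 0 := by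
      intro h
      apply hx
      change _ * (tent (n⁻¹ • I x) * _) ^ (2 / p) = 0
      rw [h, Real.zero_rpow hp2.ne', mul_zero]
    obtain ⟨ha, hb⟩ := mul_ne_zero_iff.1 h0
    have h1 := norm_lt_one_of_tent_ne_zero ha
    obtain ⟨h2, h3⟩ := mem_Ioo_of_logTent_ne_zero hn (hM x) hb
    rw [norm_smul, norm_inv, Real.norm_of_nonneg hn.le, inv_mul_lt_one₀ hn] at h1
    have h4 : Real.exp (-2 * n) < x (Fin.last m) := by
      rcases lt_max_iff.1 h2 with h | h
      · exact h
      · exact absurd h (lt_irrefl _)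
    exact ⟨⟨h1.le, h4.le⟩, (le_max_left _ _).trans h3.le⟩
  refine ⟨?_, HasCompactSupport.of_support_subset_isCompact hSK hsupp, ?_⟩
  · have hT : Continuous fun x : EuclideanSpace ℝ (Fin (m + 1)) =>
        logTent n (max (x (Fin.last m)) (Real.exp (-2 * n))) :=
      continuous_tent.comp (((hMc.log fun x => (hM x).ne').div_const n).add continuous_const)
    exact (hMc.rpow_const fun x => Or.inl (hM x).ne').mul
      (((continuous_tent.comp (hI.const_smul n⁻¹)).mul hT).rpow_const fun x => Or.inr hp2.le)
  · refine (closure_minimal hsupp hSc).trans fun x hx => ?_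
    exact hε.trans_le hx.1.2

/-! ### Optimality of the constant -/

theorem lintegral_ofReal_two_mul_add_ne_top {a b : ℝ} {w : ℝ → ℝ} (hw : Measurable w)
    (hw0 : ∀ t ∈ Set.Ioo (0 : ℝ) 1, 0 ≤ w t)
    (ha : ∫⁻ t in Set.Ioo (0 : ℝ) 1, ENNReal.ofReal (t ^ a * w t) ≠ ∞)
    (hb : ∫⁻ t in Set.Ioo (0 : ℝ) 1, ENNReal.ofReal (t ^ b * w t) ≠ ∞) :
    ∫⁻ t in Set.Ioo (0 : ℝ) 1, ENNReal.ofReal (2 * (t ^ a + t ^ b) * w t) ≠ ∞ := by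
  have : ∫⁻ t in Set.Ioo (0 : ℝ) 1, ENNReal.ofReal (2 * (t ^ a + t ^ b) * w t) =
      ENNReal.ofReal 2 * ((∫⁻ t in Set.Ioo (0 : ℝ) 1, ENNReal.ofReal (t ^ a * w t)) +
        ∫⁻ t in Set.Ioo (0 : ℝ) 1, ENNReal.ofReal (t ^ b * w t)) := by
    rw [← lintegral_add_left (by fun_prop), ← lintegral_const_mul' _ _ ENNReal.ofReal_ne_top]
    refine setLIntegral_congr_fun measurableSet_Ioo fun t ht => ?_
    have h0 := ht.1
    have h1 := hw0 t ht
    rw [← ENNReal.ofReal_add (by positivity) (by positivity), ← ENNReal.ofReal_mul zero_le_two]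
    congr 1
    ring
  rw [this]
  exact ENNReal.mul_ne_top ENNReal.ofReal_ne_top (ENNReal.add_ne_top.2 ⟨ha, hb⟩)

theorem exists_sobolevBregmanForm_lt (m : ℕ) (hd : 1 ≤ m + 1) {p α C : ℝ} (hp : 1 < p)
    (hα0 : 0 < α) (hα2 : α < 2) (hC : hardyConst (m + 1) p α < C) :
    ∃ u : EuclideanSpace ℝ (Fin (m + 1)) → ℝ, IsCc (halfSpace hd) u ∧
      sobolevBregmanForm (halfSpace hd) p α u < ENNReal.ofReal C * hardyTerm hd p α u := by
  have hp0 : p ≠ 0 := by linarith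
  have hκ := (ofReal_hardyConst m hp hα0 hα2).1
  obtain ⟨hβ1, hγ1⟩ := abs_hardyExponent_lt_one hp hα0 hα2
  have hβ : p * ((α - 1) / p) = α - 1 := by field_simp
  set β := (α - 1) / p with hβdef
  -- The midpoint of α and 2: s < 1 + α makes the s-th kernel moment finite, s > α makes (1 -
  -- t)^{s-1-α} integrable at 1, and s ≤ 2 is needed for the tent increments.
  set s := (α + 2) / 2 with hs
  have hs0 : 0 ≤ s := by linarith
  have hs2 : s ≤ 2 := by linarith
  set A := ∫⁻ z : EuclideanSpace ℝ (Fin m), ENNReal.ofReal (tent z ^ 2) with hA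
  set A₁ := ∫⁻ r : ℝ, ENNReal.ofReal (tent r ^ 2) with hA₁
  have hAt : A ≠ ∞ := lintegral_tent_sq_ne_top
  have hA₁t : A₁ ≠ ∞ := lintegral_tent_sq_ne_top
  have hA0 : A ≠ 0 := lintegral_tent_sq_ne_zero
  have hA₁0 : A₁ ≠ 0 := lintegral_tent_sq_ne_zero
  set J₁ := ∫⁻ t in Set.Ioo (0 : ℝ) 1,
    ENNReal.ofReal (2 * (t ^ β + t ^ ((p - 1) * β)) * (1 - t) ^ (s - 1 - α)) with hJ₁
  set J₂ := ∫⁻ t in Set.Ioo (0 : ℝ) 1, ENNReal.ofReal (2 * (t ^ β + t ^ ((p - 1) * β)) *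
    ((1 - t) ^ (-1 - α) * Real.log t ^ 2)) with hJ₂
  have hJ₁t : J₁ ≠ ∞ := by
    refine lintegral_ofReal_two_mul_add_ne_top (by fun_prop)
      (fun t ht => Real.rpow_nonneg (by linarith [ht.2]) _) ?_ ?_
    · exact lintegral_rpow_mul_one_sub_rpow_ne_top (abs_lt.1 hβ1).1 (by linarith)
    · exact lintegral_rpow_mul_one_sub_rpow_ne_top (abs_lt.1 hγ1).1 (by linarith)
  have hJ₂t : J₂ ≠ ∞ := by
    refine lintegral_ofReal_two_mul_add_ne_top (by fun_prop)
      (fun t ht => mul_nonneg (Real.rpow_nonneg (by linarith [ht.2]) _) (sq_nonneg _)) ?_ ?_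
    · exact lintegral_rpow_mul_log_sq_ne_top hβ1 hα2
    · exact lintegral_rpow_mul_log_sq_ne_top hγ1 hα2
  set X := (2 * volume (Metric.ball (0 : EuclideanSpace ℝ (Fin m)) 1) * slabMoment m α s) * A₁
    with hX
  set Y := ENNReal.ofReal (slabConst m α) * (2 * volume (Metric.ball (0 : ℝ) 1)) * A with hY
  have hXt : X ≠ ∞ := ENNReal.mul_ne_top (ENNReal.mul_ne_top (ENNReal.mul_ne_top (by norm_num)
    measure_ball_lt_top.ne) (slabMoment_ne_top m hs0 (by linarith))) hA₁t
  have hYt : Y ≠ ∞ := ENNReal.mul_ne_top (ENNReal.mul_ne_top ENNReal.ofReal_ne_top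
    (ENNReal.mul_ne_top (by norm_num) measure_ball_lt_top.ne)) hAt
  -- An upper bound for the form divided by n^{m+1}: both remainder terms decay, leaving κ times the
  -- normalised Hardy term A · A₁.
  have hlim : Filter.Tendsto (fun n : ℝ => ENNReal.ofReal (n ^ (-s)) * (X * J₁) +
      ENNReal.ofReal (n ^ (-2 : ℝ)) * (Y * J₂) +
        ENNReal.ofReal (hardyConst (m + 1) p α) * (A * A₁)) Filter.atTop
      (nhds (ENNReal.ofReal 0 * (X * J₁) + ENNReal.ofReal 0 * (Y * J₂) +
        ENNReal.ofReal (hardyConst (m + 1) p α) * (A * A₁))) := by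
    refine ((ENNReal.Tendsto.mul_const (ENNReal.tendsto_ofReal ?_) (Or.inr ?_)).add
      (ENNReal.Tendsto.mul_const (ENNReal.tendsto_ofReal ?_) (Or.inr ?_))).add tendsto_const_nhds
    · exact tendsto_rpow_neg_atTop (by linarith)
    · exact ENNReal.mul_ne_top hXt hJ₁t
    · exact tendsto_rpow_neg_atTop two_pos
    · exact ENNReal.mul_ne_top hYt hJ₂t
  simp only [ENNReal.ofReal_zero, zero_mul, zero_add] at hlim
  have hlt : ENNReal.ofReal (hardyConst (m + 1) p α) * (A * A₁) < ENNReal.ofReal C * (A * A₁) := by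
    rw [ENNReal.mul_lt_mul_iff_left (mul_ne_zero hA0 hA₁0) (ENNReal.mul_ne_top hAt hA₁t)]
    exact (ENNReal.ofReal_lt_ofReal_iff (hκ.trans_lt hC)).2 hC
  obtain ⟨n, hnlt, hn⟩ := ((hlim.eventually_lt_const hlt).and (Filter.eventually_gt_atTop 0)).exists
  have hu := isCc_hardyTest hd (β := β) hp hn
  refine ⟨hardyTest m p β n, hu, ?_⟩
  have hU : ∀ (z : EuclideanSpace ℝ (Fin m)) (x : ℝ), 0 < x →
      hardyTest m p β n (snocEquiv m (z, x)) =
        x ^ β * (tent (n⁻¹ • z) * logTent n x) ^ (2 / p) := fun z x hx =>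
    hardyTest_snocEquiv hp hn z hx
  have hH : hardyTerm hd p α (hardyTest m p β n) = ENNReal.ofReal (n ^ m * n) * (A * A₁) := by
    rw [hardyTerm_eq_slabHardy m hd hu.1.measurable]
    exact slabHardy_test hp hβ hn hU
  have hrem : ∫⁻ t in Set.Ioo (0 : ℝ) 1,
      remainderSection m p α β t (fun z x => hardyTest m p β n (snocEquiv m (z, x))) ≤
      ENNReal.ofReal (n ^ m * n) * (ENNReal.ofReal (n ^ (-s)) * (X * J₁) +
        ENNReal.ofReal (n ^ (-2 : ℝ)) * (Y * J₂)) := by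
    refine (setLIntegral_mono' measurableSet_Ioo fun t ht =>
      remainderSection_le hp hα0 hβ hs0 hs2 hn ht.1 ht.2 hU).trans_eq ?_
    rw [lintegral_const_mul' _ _ ENNReal.ofReal_ne_top, lintegral_add_left (by fun_prop),
      lintegral_const_mul _ (by fun_prop), lintegral_const_mul _ (by fun_prop),
      ← mul_assoc _ X, ← mul_assoc _ Y]
  rw [sobolevBregmanForm_eq_remainder_add m hd hp hα0 hα2 hu, hH]
  have hn0 : ENNReal.ofReal (n ^ m * n) ≠ 0 := by
    rw [Ne, ENNReal.ofReal_eq_zero, not_le]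
    positivity
  calc _ ≤ ENNReal.ofReal (n ^ m * n) * (ENNReal.ofReal (n ^ (-s)) * (X * J₁) +
        ENNReal.ofReal (n ^ (-2 : ℝ)) * (Y * J₂)) + ENNReal.ofReal (hardyConst (m + 1) p α) *
          (ENNReal.ofReal (n ^ m * n) * (A * A₁)) := add_le_add hrem le_rfl
    _ = ENNReal.ofReal (n ^ m * n) * (ENNReal.ofReal (n ^ (-s)) * (X * J₁) +
        ENNReal.ofReal (n ^ (-2 : ℝ)) * (Y * J₂) +
          ENNReal.ofReal (hardyConst (m + 1) p α) * (A * A₁)) := by ring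
    _ < ENNReal.ofReal (n ^ m * n) * (ENNReal.ofReal C * (A * A₁)) :=
        (ENNReal.mul_lt_mul_iff_right hn0 ENNReal.ofReal_ne_top).2 hnlt
    _ = _ := by ring

theorem theorem1 (d : ℕ) (hd : 1 ≤ d) (p : ℝ) (hp : 1 < p) (α : ℝ) (hα0 : 0 < α) (hα2 : α < 2) :
    (∀ u : EuclideanSpace ℝ (Fin d) → ℝ, IsCc (halfSpace hd) u →
      ENNReal.ofReal (hardyConst d p α) * hardyTerm hd p α u
        ≤ sobolevBregmanForm (halfSpace hd) p α u) ∧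
    (∀ C : ℝ, hardyConst d p α < C →
      ∃ u : EuclideanSpace ℝ (Fin d) → ℝ, IsCc (halfSpace hd) u ∧
        sobolevBregmanForm (halfSpace hd) p α u
          < ENNReal.ofReal C * hardyTerm hd p α u) := by
  obtain ⟨m, rfl⟩ : ∃ m, d = m + 1 := ⟨d - 1, by omega⟩
  refine ⟨fun u hu => ?_, fun C hC => exists_sobolevBregmanForm_lt m hd hp hα0 hα2 hC⟩
  rw [sobolevBregmanForm_eq_remainder_add m hd hp hα0 hα2 hu]
  exact le_add_self
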